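/- Throughout, a model category is a (closed) model category with all small limits and colimits, and $\mathcal S$ is the category of simplicial sets. For a model category $\mathcal C$ let $s\mathcal C$ be the category of simplicial objects in $\mathcal C$, with its standard simplicial structure: $(X\otimes K)_n=\coprod_{K_n}X_n$ and $\mathrm{map}(X,Y)_n=s\mathcal C(X\otimes\Delta[n],Y)$. Let $L_nX$ and $M_nX$ be the $n$th latching and matching objects of $X$. A map $X\to Y$ in $s\mathcal C$ is a level weak equivalence if every $X_n\to Y_n$ is a weak equivalence, a Reedy cofibration if every $X_n\amalg_{L_nX}L_nY\to Y_n$ is a cofibration, and a Reedy fibration if every $X_n\to Y_n\times_{M_nY}M_nX$ is a fibration; $X$ is homotopically constant if all its face and degeneracy operators are weak equivalences. A model structure on $s\mathcal C$ is called canonical if every level weak equivalence is a weak equivalence, the cofibrations are the Reedy cofibrations, and the fibrant objects are the homotopically constant Reedy fibrant objects. It is called simplicial if it satisfies SM7: for every cofibration $f\colon A\to B$ in $s\mathcal C$ and every monomorphism $i\colon K\to L$ in $\mathcal S$, the map $A\otimes L\amalg_{A\otimes K}B\otimes K\to B\otimes L$ is a cofibration, and it is a weak equivalence if $f$ or $i$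 is one. An adjunction $F\dashv G$ between model categories is a Quillen adjoint pair if $F$ preserves cofibrations and trivial cofibrations, and then a Quillen equivalence if the total left derived functor of $F$ and the total right derived functor of $G$ form an equivalence of homotopy categories. **Proposition.** Let $\mathcal C$ and $\mathcal D$ be model categories such that $s\mathcal C$ and $s\mathcal D$ have canonical model structures that are simplicial, and equip $s\mathcal C$ and $s\mathcal D$ with these structures. Let $L\colon\mathcal C\to\mathcal D$ and $R\colon\mathcal D\to\mathcal C$ be a Quillen adjoint pair, and let $\bar L\colon s\mathcal C\to s\mathcal D$ and $\bar R\colon s\mathcal D\to s\mathcal C$ be the functors that apply $L$ and $R$ in each simplicial degree, with the levelwise adjunction $\bar L\dashv\bar R$. Then: 1. $\bar L,\bar R$ is a Quillen adjoint pair. 2. $\bar L,\bar R$ is a simplicial adjoint pair: $\bar L$ and $\bar R$ are simplicial functors, acting levelwise on mapping spaces, and there are isomorphisms of simplicial sets $\mathrm{map}_{s\mathcal D}(\bar LX,Y)\cong\mathrm{map}_{s\mathcal C}(X,\bar RY)$, natural in the enriched sense in $X$ and $Y$, that extend the bijections of the adjunction on vertices. 3. If $L,R$ is a Quillen equivalence,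 then so is $\bar L,\bar R$. -/

import Mathlib

open CategoryTheory CategoryTheory.Limits HomotopicalAlgebra Opposite Simplicial MonoidalCategory

universe v u u₁ u₂

noncomputable section

namespace SimplicialReplacement

/-! ### Simplicial functors and simplicial adjunctions -/

section Enriched

variable {M : Type u₁} [Category.{v} M] [SimplicialCategory M]
  {N : Type u₂} [Category.{v} N] [SimplicialCategory N]

/-- The structure of a simplicial functor on an ordinary functor `F` between simplicial
categories: maps of simplicial mapping spaces which are unital, associative, and which
restrict to `F` on vertices. -/
structure SimplicialFunctorStructure (F : M ⥤ N) where
  map (X Y : M) : SimplicialCategory.sHom X Y ⟶ SimplicialCategory.sHom (F.obj X) (F.obj Y)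
  map_id (X : M) : eId SSet.{v} X ≫ map X X = eId SSet.{v} (F.obj X)
  map_comp (X Y Z : M) :
    SimplicialCategory.sHomComp X Y Z ≫ map X Z =
      (map X Y ⊗ₘ map Y Z) ≫ SimplicialCategory.sHomComp (F.obj X) (F.obj Y) (F.obj Z)
  map_vertex {X Y : M} (f : X ⟶ Y) :
    eHomEquiv SSet.{v} f ≫ map X Y = eHomEquiv SSet.{v} (F.map f)

/-- The structure of a simplicial adjunction on an ordinary adjunction `adj : F ⊣ G`:
simplicial structures on both functors, and isomorphisms of simplicial mapping spaces
`map(F X, Y) ≅ map(X, G Y)` which are natural in the enriched sense in both variables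
and which restrict to the bijection of `adj` on vertices. -/
structure SimplicialAdjunction {F : M ⥤ N} {G : N ⥤ M} (adj : F ⊣ G) where
  left : SimplicialFunctorStructure F
  right : SimplicialFunctorStructure G
  iso (X : M) (Y : N) :
    SimplicialCategory.sHom (F.obj X) Y ≅ SimplicialCategory.sHom X (G.obj Y)
  iso_vertex {X : M} {Y : N} (f : F.obj X ⟶ Y) :
    eHomEquiv SSet.{v} f ≫ (iso X Y).hom = eHomEquiv SSet.{v} (adj.homEquiv X Y f)
  naturality_left (X' X : M) (Y : N) :
    (left.map X' X ▷ SimplicialCategory.sHom (F.obj X) Y) ≫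
        SimplicialCategory.sHomComp (F.obj X') (F.obj X) Y ≫ (iso X' Y).hom =
      (SimplicialCategory.sHom X' X ◁ (iso X Y).hom) ≫
        SimplicialCategory.sHomComp X' X (G.obj Y)
  naturality_right (X : M) (Y Y' : N) :
    SimplicialCategory.sHomComp (F.obj X) Y Y' ≫ (iso X Y').hom =
      ((iso X Y).hom ⊗ₘ right.map Y Y') ≫
        SimplicialCategory.sHomComp X (G.obj Y) (G.obj Y')

end Enriched

/-! ### Quillen adjunctions and Quillen equivalences -/

section Quillen

variable {M : Type u₁} [Category.{v} M] [ModelCategory M]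
  {N : Type u₂} [Category.{v} N] [ModelCategory N]

/-- An adjunction between model categories is a Quillen adjunction if the left adjoint
preserves cofibrations and trivial cofibrations. -/
structure IsQuillenAdjunction {F : M ⥤ N} {G : N ⥤ M} (_adj : F ⊣ G) : Prop where
  cofibration {X Y : M} (f : X ⟶ Y) : cofibrations M f → cofibrations N (F.map f)
  trivialCofibration {X Y : M} (f : X ⟶ Y) :
    trivialCofibrations M f → trivialCofibrations N (F.map f)

/-- A Quillen adjunction is a Quillen equivalence if there is an equivalence of homotopy
categories whose functor is the total left derived functor of the left adjoint and whose
inverse is the total right derived functor of the right adjoint. The homotopy category is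
the localization at the weak equivalences. -/
structure IsQuillenEquivalence {F : M ⥤ N} {G : N ⥤ M} (adj : F ⊣ G) : Prop where
  isQuillenAdjunction : IsQuillenAdjunction adj
  exists_equivalence :
    ∃ (E : (weakEquivalences M).Localization ≌ (weakEquivalences N).Localization)
      (α : (weakEquivalences M).Q ⋙ E.functor ⟶ F ⋙ (weakEquivalences N).Q)
      (β : G ⋙ (weakEquivalences M).Q ⟶ (weakEquivalences N).Q ⋙ E.inverse),
      E.functor.IsLeftDerivedFunctor α (weakEquivalences M) ∧
        E.inverse.IsRightDerivedFunctor β (weakEquivalences N)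

end Quillen

/-! ### The tensor of simplicial objects with simplicial sets -/

section Tensor

variable {C : Type u} [Category.{v} C] [HasColimits C]

/-- The tensor `X ⊗ K` of a simplicial object `X` with a simplicial set `K`:
in degree `n` it is the coproduct of copies of `X_n` indexed by `K_n`. -/
def tensorObj (X : SimplicialObject C) (K : SSet.{v}) : SimplicialObject C where
  obj n := ∐ fun _ : K.obj n => X.obj n
  map {m n} g := Sigma.desc fun k => X.map g ≫ Sigma.ι (fun _ : K.obj n => X.obj n) (K.map g k)
  map_id n := by
    apply Sigma.hom_ext
    intro k
    simp
  map_comp f g := by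
    apply Sigma.hom_ext
    intro k
    simp

/-- The functoriality of the tensor in both variables. -/
def tensorMap {X Y : SimplicialObject C} (f : X ⟶ Y) {K L : SSet.{v}} (i : K ⟶ L) :
    tensorObj X K ⟶ tensorObj Y L where
  app n := Sigma.desc fun k => f.app n ≫ Sigma.ι (fun _ : L.obj n => Y.obj n) (i.app n k)
  naturality m n g := by
    apply Sigma.hom_ext
    intro k
    have := ConcreteCategory.congr_hom (i.naturality g) k
    simp [tensorObj]

lemma tensorMap_comp {X Y Z : SimplicialObject C} (f : X ⟶ Y) (g : Y ⟶ Z)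
    {K L P : SSet.{v}} (i : K ⟶ L) (j : L ⟶ P) :
    tensorMap (f ≫ g) (i ≫ j) = tensorMap f i ≫ tensorMap g j := by
  apply NatTrans.ext
  funext n
  apply Sigma.hom_ext
  intro k
  dsimp only [tensorMap, tensorObj, NatTrans.comp_app]
  rw [Sigma.ι_desc, Sigma.ι_desc_assoc, Category.assoc, Category.assoc, Sigma.ι_desc]
  rfl

/-- The tensor is compatible with the simplicial enrichment of simplicial objects:
`Hom(X ⊗ K, Y) ≃ Hom(K, map(X, Y))`. For `K = Δ[n]` this identifies the `n`-simplices of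
`map(X, Y)` with the morphisms `X ⊗ Δ[n] ⟶ Y`. -/
def tensorHomEquiv (X Y : SimplicialObject C) (K : SSet.{v}) :
    (tensorObj X K ⟶ Y) ≃ (K ⟶ SimplicialCategory.sHom X Y) :=
  Equiv.trans
    { toFun := fun φ =>
        ({ app := fun n k => Sigma.ι (fun _ : K.obj n => X.obj n) k ≫ φ.app n
           naturality := fun {m n} g k => by
             have := Sigma.ι (fun _ : K.obj m => X.obj m) k ≫= φ.naturality g
             simpa [tensorObj] using this } : Functor.HomObj X Y K)
      invFun := fun x =>
        { app := fun n => Sigma.desc fun k => x.app n k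
          naturality := fun m n g => by
            apply Sigma.hom_ext
            intro k
            simp [tensorObj] }
      left_inv := fun φ => by
        apply NatTrans.ext
        funext n
        apply Sigma.hom_ext
        intro k
        simp
      right_inv := fun x => by
        apply Functor.HomObj.ext
        funext n k
        simp }
    (Functor.functorHomEquiv (F := X) (G := Y) K).symm

variable [HasPushouts (SimplicialObject C)]

/-- The pushout-product map `A ⊗ L ∐_{A ⊗ K} B ⊗ K ⟶ B ⊗ L`. -/
def pushoutProduct {A B : SimplicialObject C} (f : A ⟶ B) {K L : SSet.{v}} (i : K ⟶ L) :
    pushout (tensorMap (𝟙 A) i) (tensorMap f (𝟙 K)) ⟶ tensorObj B L :=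
  pushout.desc (tensorMap f (𝟙 L)) (tensorMap (𝟙 B) i) (by
    rw [← tensorMap_comp, ← tensorMap_comp]
    simp)

end Tensor

/-- A map of simplicial sets is a weak equivalence if its geometric realization is a
homotopy equivalence. -/
def IsSSetWeakEquivalence {K L : SSet.{v}} (i : K ⟶ L) : Prop :=
  ∃ e : ContinuousMap.HomotopyEquiv (SSet.toTop.obj K) (SSet.toTop.obj L),
    e.toFun = (SSet.toTop.map i).hom

/-- Axiom SM7 for a model category structure on the category of simplicial objects in `C`,
with its standard simplicial structure. The cofibrations of simplicial sets are the
monomorphisms. -/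
structure IsSimplicialModelStructure (C : Type u) [Category.{v} C] [HasColimits C]
    [ModelCategory (SimplicialObject C)] : Prop where
  cofibration {A B : SimplicialObject C} (f : A ⟶ B) {K L : SSet.{v}} (i : K ⟶ L) :
    cofibrations _ f → Mono i → cofibrations _ (pushoutProduct f i)
  weakEquivalence_left {A B : SimplicialObject C} (f : A ⟶ B) {K L : SSet.{v}} (i : K ⟶ L) :
    cofibrations _ f → Mono i → weakEquivalences _ f →
      weakEquivalences _ (pushoutProduct f i)
  weakEquivalence_right {A B : SimplicialObject C} (f : A ⟶ B) {K L : SSet.{v}} (i : K ⟶ L) :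
    cofibrations _ f → Mono i → IsSSetWeakEquivalence i →
      weakEquivalences _ (pushoutProduct f i)

/-! ### Reedy cofibrations and Reedy fibrations of simplicial objects -/

/-- The index category of the `n`th latching object: the maps `[j] ⟶ [n]` in `Δᵒᵖ` with
`j < n`, and the commuting triangles. -/
abbrev LatchingIndex (n : ℕ) : Type :=
  ObjectProperty.FullSubcategory
    (fun a : Over (op ⦋n⦌ : SimplexCategoryᵒᵖ) => a.left.unop.len < n)

/-- The index category of the `n`th matching object: the maps `[n] ⟶ [j]` in `Δᵒᵖ` with
`j < n`, and the commuting triangles. -/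
abbrev MatchingIndex (n : ℕ) : Type :=
  ObjectProperty.FullSubcategory
    (fun a : Under (op ⦋n⦌ : SimplexCategoryᵒᵖ) => a.right.unop.len < n)

/-- The forgetful functor from the latching category. -/
abbrev latchingForget (n : ℕ) : LatchingIndex n ⥤ SimplexCategoryᵒᵖ :=
  ObjectProperty.ι _ ⋙ Over.forget (op ⦋n⦌ : SimplexCategoryᵒᵖ)

/-- The forgetful functor from the matching category. -/
abbrev matchingForget (n : ℕ) : MatchingIndex n ⥤ SimplexCategoryᵒᵖ :=
  ObjectProperty.ι _ ⋙ Under.forget (op ⦋n⦌ : SimplexCategoryᵒᵖ)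

section Reedy

variable {C : Type u} [Category.{v} C]

section Latching

variable [HasColimits C]

/-- The `n`th latching object. -/
abbrev latchingObj (X : SimplicialObject C) (n : ℕ) : C :=
  colimit (latchingForget n ⋙ X)

/-- The map `L_n X ⟶ X_n`. -/
def latchingMap (X : SimplicialObject C) (n : ℕ) : latchingObj X n ⟶ X _⦋n⦌ :=
  colimit.desc (latchingForget n ⋙ X)
    { pt := X _⦋n⦌
      ι :=
        { app := fun a => X.map a.obj.hom
          naturality := fun a b g => by
            have h := Over.w g.hom
            dsimp
            rw [Category.comp_id, ← X.map_comp]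
            exact congrArg X.map h } }

/-- The map `L_n X ⟶ L_n Y` induced by `f : X ⟶ Y`. -/
def latchingObjMap {X Y : SimplicialObject C} (f : X ⟶ Y) (n : ℕ) :
    latchingObj X n ⟶ latchingObj Y n :=
  colimMap (Functor.whiskerLeft (latchingForget n) f)

lemma latchingMap_naturality {X Y : SimplicialObject C} (f : X ⟶ Y) (n : ℕ) :
    latchingMap X n ≫ f.app (op ⦋n⦌) = latchingObjMap f n ≫ latchingMap Y n := by
  apply colimit.hom_ext
  intro a
  dsimp only [latchingMap, latchingObjMap, latchingObj]
  rw [colimit.ι_desc_assoc, ι_colimMap_assoc, colimit.ι_desc]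
  exact f.naturality a.obj.hom

/-- The map `X_n ∐_{L_n X} L_n Y ⟶ Y_n`. -/
def relativeLatchingMap {X Y : SimplicialObject C} (f : X ⟶ Y) (n : ℕ) :
    pushout (latchingMap X n) (latchingObjMap f n) ⟶ Y _⦋n⦌ :=
  pushout.desc (f.app (op ⦋n⦌)) (latchingMap Y n) (latchingMap_naturality f n)

end Latching

section Matching

variable [HasLimits C]

/-- The `n`th matching object. -/
abbrev matchingObj (X : SimplicialObject C) (n : ℕ) : C :=
  limit (matchingForget n ⋙ X)

/-- The map `X_n ⟶ M_n X`. -/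
def matchingMap (X : SimplicialObject C) (n : ℕ) : X _⦋n⦌ ⟶ matchingObj X n :=
  limit.lift (matchingForget n ⋙ X)
    { pt := X _⦋n⦌
      π :=
        { app := fun a => X.map a.obj.hom
          naturality := fun a b g => by
            have h := Under.w g.hom
            dsimp
            rw [Category.id_comp, ← X.map_comp]
            exact congrArg X.map h.symm } }

/-- The map `M_n X ⟶ M_n Y` induced by `f : X ⟶ Y`. -/
def matchingObjMap {X Y : SimplicialObject C} (f : X ⟶ Y) (n : ℕ) :
    matchingObj X n ⟶ matchingObj Y n :=
  limMap (Functor.whiskerLeft (matchingForget n) f)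

lemma matchingMap_naturality {X Y : SimplicialObject C} (f : X ⟶ Y) (n : ℕ) :
    f.app (op ⦋n⦌) ≫ matchingMap Y n = matchingMap X n ≫ matchingObjMap f n := by
  apply limit.hom_ext
  intro a
  dsimp only [matchingMap, matchingObjMap, matchingObj]
  rw [Category.assoc, Category.assoc, limMap_π, limit.lift_π, limit.lift_π_assoc]
  exact (f.naturality a.obj.hom).symm

/-- The map `X_n ⟶ Y_n ×_{M_n Y} M_n X`. -/
def relativeMatchingMap {X Y : SimplicialObject C} (f : X ⟶ Y) (n : ℕ) :
    X _⦋n⦌ ⟶ pullback (matchingMap Y n) (matchingObjMap f n) :=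
  pullback.lift (f.app (op ⦋n⦌)) (matchingMap X n) (matchingMap_naturality f n)

end Matching

variable [ModelCategory C]

/-- Level weak equivalences of simplicial objects. -/
def IsLevelWeakEquivalence {X Y : SimplicialObject C} (f : X ⟶ Y) : Prop :=
  ∀ n : ℕ, weakEquivalences C (f.app (op ⦋n⦌))

/-- Reedy cofibrations of simplicial objects. -/
def IsReedyCofibration [HasColimits C] {X Y : SimplicialObject C} (f : X ⟶ Y) : Prop :=
  ∀ n : ℕ, cofibrations C (relativeLatchingMap f n)

/-- Reedy fibrations of simplicial objects. -/
def IsReedyFibration [HasLimits C] {X Y : SimplicialObject C} (f : X ⟶ Y) : Prop :=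
  ∀ n : ℕ, fibrations C (relativeMatchingMap f n)

/-- A simplicial object is homotopically constant if all its face and degeneracy operators
are weak equivalences. -/
def IsHomotopicallyConstant (X : SimplicialObject C) : Prop :=
  (∀ (n : ℕ) (i : Fin (n + 2)), weakEquivalences C (X.δ i)) ∧
    ∀ (n : ℕ) (i : Fin (n + 1)), weakEquivalences C (X.σ i)

end Reedy

/-! ### The canonical model structure -/

/-- The given model structure on the category of simplicial objects in the model category
`C` is the canonical one: every level weak equivalence is a weak equivalence, the
cofibrations are the Reedy cofibrations, and the fibrant objects are the homotopically
constant, Reedy fibrant objects. -/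
structure IsCanonicalModelStructure (C : Type u) [Category.{v} C] [HasLimits C]
    [HasColimits C] [ModelCategory C] [ModelCategory (SimplicialObject C)] : Prop where
  weakEquivalence_of_level {X Y : SimplicialObject C} (f : X ⟶ Y) :
    IsLevelWeakEquivalence f → weakEquivalences (SimplicialObject C) f
  cofibration_iff {X Y : SimplicialObject C} (f : X ⟶ Y) :
    cofibrations (SimplicialObject C) f ↔ IsReedyCofibration f
  isFibrant_iff (X : SimplicialObject C) :
    IsFibrant X ↔ IsHomotopicallyConstant X ∧ IsReedyFibration (terminal.from X)

/-! ### Prolongations -/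

section Prolongation

variable {C : Type u₁} [Category.{v} C] {D : Type u₂} [Category.{v} D]

/-- The prolongation of a functor, which applies it in each simplicial degree. -/
abbrev prolong (F : C ⥤ D) : SimplicialObject C ⥤ SimplicialObject D :=
  (SimplicialObject.whiskering C D).obj F

/-- The prolongation of an adjunction. -/
abbrev prolongAdj {L : C ⥤ D} {R : D ⥤ C} (adj : L ⊣ R) : prolong L ⊣ prolong R :=
  adj.whiskerRight SimplexCategoryᵒᵖ

/-- A simplicial structure on the prolongation of `F` is levelwise if it is obtained by
applying `F` in each degree: an `n`-simplex of `map(X, Y)` is a compatible family of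
morphisms `X_m ⟶ Y_m` indexed by the `m`-simplices of `Δ[n]`, and it is sent to the family
of the images under `F`. -/
def SimplicialFunctorStructure.IsLevelwise {F : C ⥤ D}
    (S : SimplicialFunctorStructure (prolong F)) : Prop :=
  ∀ (X Y : SimplicialObject C) (n : SimplexCategoryᵒᵖ) (x : (Functor.functorHom X Y).obj n)
    (m : SimplexCategoryᵒᵖ) (g : n ⟶ m),
    Functor.HomObj.app
        (show (Functor.functorHom ((prolong F).obj X) ((prolong F).obj Y)).obj n from
          (S.map X Y).app n x) m g =
      F.map (x.app m g)

end Prolongation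

end SimplicialReplacement

end

/-!
The prolongation `L̄ ⊣ R̄` of a Quillen adjunction `L ⊣ R` is a levelwise construction, so its
simplicial structure is the evident one: a simplex of a mapping space is a family of morphisms, and
the functors and the adjunction act on each member of the family (`prolongSimplicialAdjunction`).

*Quillen adjunction.* `L̄` preserves Reedy cofibrations and `R̄` preserves Reedy fibrant objects,
since lifting problems against relative latching maps and against matching maps are transposed
along `L ⊣ R`. Tensors of maps of constant objects with `Δ[n]` are cofibrations by SM7, so the
components of fibrations are fibrations; in particular fibrant objects are levelwise fibrant, and
`R̄` preserves homotopical constancy of fibrant objects, hence fibrant objects. The image of a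
trivial cofibration `j` under `L̄` is a weak equivalence because a cofibration is a weak equivalence
as soon as it, and its pushout-product with the ends of the interval, extend maps to fibrant
objects (`IsSimplicialModelStructure.weakEquivalence_of_extension`). These extension problems for
`L̄ j` are transposed to extension problems for `j` with values in the fibrant objects `R̄ Z`.

*Quillen equivalence.* By the general criterion `IsQuillenAdjunction.isQuillenEquivalence`, it is
enough that the derived counit of the prolonged adjunction is a weak equivalence and that every
bifibrant object `X` is weakly equivalent to some `R̄ W` with `W` fibrant. Cofibrant objects are
levelwise cofibrant (`IsReedyCofibration.cofibration_app`) and fibrant objects are levelwise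
fibrant, so both statements follow levelwise from the fact that for a Quillen equivalence a
morphism `L A ⟶ B` with `A` cofibrant and `B` fibrant is a weak equivalence if and only if its
adjoint is. For the first one uses that trivial fibrations are level weak equivalences. For the
second, `W` is a Reedy fibrant replacement of `L̄ X` up to level weak equivalence
(`exists_reedyFibrant_replacement`), which is homotopically constant as `X` is.
-/

noncomputable section

namespace SimplicialReplacement

/-! ### The prolonged adjunction is simplicial -/

section SimplicialAdjunction

variable {C : Type u₁} [Category.{v} C] {D : Type u₂} [Category.{v} D]

/-- The image under `F` of a family of morphisms `X_m ⟶ Y_m` indexed by `A`. -/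
def homObjMap (F : C ⥤ D) {X Y : SimplicialObject C} {A : SimplexCategoryᵒᵖ ⥤ Type*}
    (x : Functor.HomObj X Y A) :
    Functor.HomObj ((prolong F).obj X) ((prolong F).obj Y) A where
  app m a := F.map (x.app m a)
  naturality f a := by
    exact (F.map_comp _ _).symm.trans ((F.congr_map (x.naturality f a)).trans (F.map_comp _ _))

/-- The map of simplicial mapping spaces which applies `F` in each degree. -/
def functorHomMap (F : C ⥤ D) (X Y : SimplicialObject C) :
    SimplicialCategory.sHom X Y ⟶
      SimplicialCategory.sHom ((prolong F).obj X) ((prolong F).obj Y) where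
  app n := ↾fun x => homObjMap (X := X) (Y := Y) (A := coyoneda.obj (op n)) F x
  naturality _ _ _ := rfl

/-- The levelwise simplicial structure on the prolongation of `F`. -/
def prolongSimplicial (F : C ⥤ D) : SimplicialFunctorStructure (prolong F) where
  map X Y := functorHomMap F X Y
  map_id X := by
    ext n a
    refine Functor.functorHom_ext fun m g => ?_
    exact F.map_id (X.obj m)
  map_comp X Y Z := by
    ext n a
    refine Functor.functorHom_ext fun m g => ?_
    exact F.map_comp _ _
  map_vertex f := by
    ext n a
    refine Functor.functorHom_ext fun m g => ?_
    rfl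

lemma prolongSimplicial_isLevelwise (F : C ⥤ D) : (prolongSimplicial F).IsLevelwise :=
  fun _ _ _ _ _ _ => rfl

variable {L : C ⥤ D} {R : D ⥤ C} (adj : L ⊣ R)

lemma prolongAdj_unit_app_app (X : SimplicialObject C) (m : SimplexCategoryᵒᵖ) :
    ((prolongAdj adj).unit.app X).app m = adj.unit.app (X.obj m) :=
  Adjunction.whiskerRight_unit_app_app _ _ _ _

lemma prolongAdj_homEquiv_app {X : SimplicialObject C} {Y : SimplicialObject D}
    (f : (prolong L).obj X ⟶ Y) (m : SimplexCategoryᵒᵖ) :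
    ((prolongAdj adj).homEquiv X Y f).app m =
      adj.homEquiv (X.obj m) (Y.obj m) (show L.obj (X.obj m) ⟶ Y.obj m from f.app m) := by
  rw [Adjunction.homEquiv_unit, Adjunction.homEquiv_unit, ← prolongAdj_unit_app_app adj X m]
  rfl

/-- The adjunction bijection, applied to families of morphisms `L X_m ⟶ Y_m` indexed by `A`. -/
def homObjEquivOfAdj (X : SimplicialObject C) (Y : SimplicialObject D)
    (A : SimplexCategoryᵒᵖ ⥤ Type*) :
    Functor.HomObj ((prolong L).obj X) Y A ≃ Functor.HomObj X ((prolong R).obj Y) A where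
  toFun x :=
    { app := fun m a => adj.homEquiv _ _ (x.app m a)
      naturality := fun f a => by
        exact (adj.homEquiv_naturality_left _ _).symm.trans
          ((congrArg (adj.homEquiv _ _) (x.naturality f a)).trans
            (adj.homEquiv_naturality_right _ _)) }
  invFun x :=
    { app := fun m a => (adj.homEquiv _ _).symm (x.app m a)
      naturality := fun f a => by
        exact (adj.homEquiv_naturality_left_symm _ _).symm.trans
          ((congrArg (adj.homEquiv _ _).symm (x.naturality f a)).trans
            (adj.homEquiv_naturality_right_symm _ _)) }
  left_inv x := Functor.HomObj.ext (by
    funext m a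
    exact (adj.homEquiv _ _).symm_apply_apply _)
  right_inv x := Functor.HomObj.ext (by
    funext m a
    exact (adj.homEquiv _ _).apply_symm_apply _)

/-- The isomorphism of simplicial mapping spaces induced by an adjunction. -/
def functorHomIsoOfAdj (X : SimplicialObject C) (Y : SimplicialObject D) :
    SimplicialCategory.sHom ((prolong L).obj X) Y ≅
      SimplicialCategory.sHom X ((prolong R).obj Y) :=
  NatIso.ofComponents
    (fun n => Equiv.toIso (homObjEquivOfAdj adj X Y (coyoneda.obj (op n)))) (fun _ => rfl)

/-- The simplicial structure on the prolongation of an adjunction. -/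
def prolongSimplicialAdjunction : SimplicialAdjunction (prolongAdj adj) where
  left := prolongSimplicial L
  right := prolongSimplicial R
  iso := functorHomIsoOfAdj adj
  iso_vertex {X Y} f := by
    ext n a
    refine Functor.functorHom_ext fun m g => ?_
    exact (prolongAdj_homEquiv_app adj f m).symm
  naturality_left X' X Y := by
    ext n a
    refine Functor.functorHom_ext fun m g => ?_
    exact adj.homEquiv_naturality_left _ _
  naturality_right X Y Y' := by
    ext n a
    refine Functor.functorHom_ext fun m g => ?_
    exact adj.homEquiv_naturality_right _ _

end SimplicialAdjunction

/-! ### Saturation of the weak equivalences -/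

section Saturation

variable {M : Type u₁} [Category.{v} M] [ModelCategory M]
  {H : Type*} [Category* H] (Q : M ⥤ H) [Q.IsLocalization (weakEquivalences M)]

lemma isIso_map_of_weakEquivalence {X Y : M} (f : X ⟶ Y) [WeakEquivalence f] :
    IsIso (Q.map f) :=
  Localization.inverts Q (weakEquivalences M) f (mem_weakEquivalences f)

/-- A fibration between bifibrant objects is a weak equivalence if it becomes an isomorphism in
the homotopy category: by the covering homotopy theorem it has a section `s`, and it is a
retract of `p ≫ s`, which is homotopic to the identity. -/
lemma weakEquivalence_of_isIso_map_of_fibration {X Y : M} [IsCofibrant X] [IsFibrant X]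
    [IsCofibrant Y] [IsFibrant Y] (p : X ⟶ Y) [Fibration p] [IsIso (Q.map p)] :
    WeakEquivalence p := by
  obtain ⟨g, hg⟩ := map_surjective_of_isLocalization Q Y X (inv (Q.map p))
  have hgp : LeftHomotopyRel (g ≫ p) (𝟙 Y) :=
    (LeftHomotopyRel.iff_map_eq Q _ _).2 (by simp [hg])
  obtain ⟨_, ⟨h⟩⟩ := hgp
  obtain ⟨P, _, ⟨h⟩⟩ := h.exists_good_cylinder
  obtain ⟨s, h', hs⟩ := h.covering_homotopy p g
  have hsp : s ≫ p = 𝟙 Y := by rw [← h'.h₁, Category.assoc, hs, h.h₁]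
  have hQs : Q.map s = inv (Q.map p) := by
    rw [← cancel_mono (Q.map p), ← Q.map_comp, hsp, Q.map_id, IsIso.inv_hom_id]
  obtain ⟨_, ⟨k⟩⟩ : LeftHomotopyRel (𝟙 X) (p ≫ s) :=
    (LeftHomotopyRel.iff_map_eq Q _ _).2 (by simp [hQs])
  have : WeakEquivalence (p ≫ s) :=
    (Cylinder.LeftHomotopy.weakEquivalence_iff _ k).1 inferInstance
  have r : RetractArrow p (p ≫ s) :=
    { i := Arrow.homMk (𝟙 X) s
      r := Arrow.homMk (𝟙 X) p (by simp [hsp])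
      retract := by ext <;> simp [hsp] }
  rw [weakEquivalence_iff] at this ⊢
  exact MorphismProperty.of_retract r this

lemma weakEquivalence_of_isIso_map_of_bifibrant {X Y : M} [IsCofibrant X] [IsFibrant X]
    [IsCofibrant Y] [IsFibrant Y] (f : X ⟶ Y) [IsIso (Q.map f)] :
    WeakEquivalence f := by
  let d := MorphismProperty.factorizationData (trivialCofibrations M) (fibrations M) f
  have := isCofibrant_of_cofibration d.i
  have := isFibrant_of_fibration d.p
  have := isIso_map_of_weakEquivalence Q d.i
  have : IsIso (Q.map d.p) := by
    have h : IsIso (Q.map d.i ≫ Q.map d.p) := by rw [← Q.map_comp, d.fac]; infer_instance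
    exact IsIso.of_isIso_comp_left (Q.map d.i) (Q.map d.p)
  have := weakEquivalence_of_isIso_map_of_fibration Q d.p
  rw [← d.fac]
  infer_instance

/-- The weak equivalences of a model category are exactly the morphisms which become
isomorphisms in the homotopy category. -/
lemma isIso_map_iff_weakEquivalence {X Y : M} (f : X ⟶ Y) :
    IsIso (Q.map f) ↔ WeakEquivalence f := by
  refine ⟨fun hf => ?_, fun _ => isIso_map_of_weakEquivalence Q f⟩
  rw [← CofibrantObject.HoCat.weakEquivalence_resolutionMap_iff]
  set g := CofibrantObject.HoCat.resolutionMap f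
  have hg : IsIso (Q.map g) := by
    have h := Q.congr_map (CofibrantObject.HoCat.resolutionMap_fac f)
    rw [Q.map_comp, Q.map_comp] at h
    have := isIso_map_of_weakEquivalence Q (CofibrantObject.HoCat.pResolutionObj X)
    have := isIso_map_of_weakEquivalence Q (CofibrantObject.HoCat.pResolutionObj Y)
    have : IsIso (Q.map g ≫ Q.map (CofibrantObject.HoCat.pResolutionObj Y)) := by
      rw [h]; infer_instance
    exact IsIso.of_isIso_comp_right (Q.map g) (Q.map (CofibrantObject.HoCat.pResolutionObj Y))
  rw [← FibrantObject.HoCat.weakEquivalence_resolutionMap_iff]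
  have := isCofibrant_of_cofibration (FibrantObject.HoCat.iResolutionObj
    (CofibrantObject.HoCat.resolutionObj X))
  have := isCofibrant_of_cofibration (FibrantObject.HoCat.iResolutionObj
    (CofibrantObject.HoCat.resolutionObj Y))
  have : IsIso (Q.map (FibrantObject.HoCat.resolutionMap g)) := by
    have h := Q.congr_map (FibrantObject.HoCat.resolutionMap_fac g)
    rw [Q.map_comp, Q.map_comp] at h
    have := isIso_map_of_weakEquivalence Q (FibrantObject.HoCat.iResolutionObj
      (CofibrantObject.HoCat.resolutionObj X))
    have := isIso_map_of_weakEquivalence Q (FibrantObject.HoCat.iResolutionObj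
      (CofibrantObject.HoCat.resolutionObj Y))
    have : IsIso (Q.map (FibrantObject.HoCat.iResolutionObj _) ≫
        Q.map (FibrantObject.HoCat.resolutionMap g)) := by
      rw [h]; infer_instance
    exact IsIso.of_isIso_comp_left (Q.map (FibrantObject.HoCat.iResolutionObj _)) _
  exact weakEquivalence_of_isIso_map_of_bifibrant Q _

end Saturation

/-! ### Left derived functors on model categories -/

section LeftDerived

open CofibrantObject.HoCat

variable {M : Type u₁} [Category.{v} M] [ModelCategory M]
  {Ho : Type*} [Category* Ho] {Q : M ⥤ Ho} [Q.IsLocalization (weakEquivalences M)]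
  {H : Type*} [Category* H] {F : M ⥤ H}

/-- A functor on the homotopy category which agrees with `F` on cofibrant objects is a left
derived functor of `F`. -/
lemma isLeftDerivedFunctor_of_isIso_app {LF : Ho ⥤ H} (α : Q ⋙ LF ⟶ F)
    (hα : ∀ (X : M) [IsCofibrant X], IsIso (α.app X)) :
    LF.IsLeftDerivedFunctor α (weakEquivalences M) where
  isRightKanExtension := by
    have hp := fun X : M => isIso_map_of_weakEquivalence Q (pResolutionObj X)
    have := Localization.full_whiskeringLeft Q (weakEquivalences M) H
    have := Localization.faithful_whiskeringLeft Q (weakEquivalences M) H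
    -- A transformation to `F` is determined by its values on cofibrant resolutions.
    let τ (G : Ho ⥤ H) (γ : Q ⋙ G ⟶ F) : Q ⋙ G ⟶ Q ⋙ LF :=
      { app := fun X => inv (G.map (Q.map (pResolutionObj X))) ≫ γ.app (resolutionObj X) ≫
          inv (α.app (resolutionObj X)) ≫ LF.map (Q.map (pResolutionObj X))
        naturality := fun X Y f => by
          have h := Q.congr_map (resolutionMap_fac f)
          have h₁ := G.congr_map h
          have h₂ := LF.congr_map h
          have h₃ := γ.naturality (resolutionMap f)
          have h₄ := α.naturality (resolutionMap f)
          simp only [Functor.map_comp, Functor.comp_map] at h₁ h₂ h₃ h₄ ⊢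
          rw [← IsIso.inv_comp_eq, ← Category.assoc, ← IsIso.eq_comp_inv] at h₄
          rw [Category.assoc, Category.assoc, Category.assoc, ← h₂, IsIso.eq_inv_comp,
            ← reassoc_of% h₁, IsIso.hom_inv_id_assoc, reassoc_of% h₃, ← reassoc_of% h₄] }
    have hτ (G : Ho ⥤ H) (γ : Q ⋙ G ⟶ F) : τ G γ ≫ α = γ := by
      ext X
      have h₁ := α.naturality (pResolutionObj X)
      have h₂ := γ.naturality (pResolutionObj X)
      simp only [Functor.comp_map] at h₁ h₂
      simp only [NatTrans.comp_app, τ, Category.assoc]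
      rw [h₁, IsIso.inv_hom_id_assoc, ← h₂, IsIso.inv_hom_id_assoc]
    have hα' {G : Ho ⥤ H} {σ σ' : Q ⋙ G ⟶ Q ⋙ LF} (h : σ ≫ α = σ' ≫ α) : σ = σ' := by
      ext X
      have h₁ := σ.naturality (pResolutionObj X)
      have h₂ := σ'.naturality (pResolutionObj X)
      have h₃ := NatTrans.congr_app h (resolutionObj X)
      simp only [Functor.comp_map, NatTrans.comp_app] at h₁ h₂ h₃
      rw [cancel_mono] at h₃
      rw [← cancel_epi (G.map (Q.map (pResolutionObj X))), h₁, h₂, h₃]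
    have hpre (S : Functor.RightExtension Q F) : ((Functor.whiskeringLeft _ _ H).obj Q).map
        (((Functor.whiskeringLeft _ _ H).obj Q).preimage (τ S.left S.hom)) ≫ α = S.hom :=
      (congrArg (· ≫ α) (((Functor.whiskeringLeft _ _ H).obj Q).map_preimage _)).trans
        (hτ S.left S.hom)
    refine ⟨⟨IsTerminal.ofUniqueHom (fun S => CostructuredArrow.homMk
      (((Functor.whiskeringLeft _ _ H).obj Q).preimage (τ S.left S.hom)) ?_) ?_⟩⟩
    · exact hpre S
    · exact fun S m => CostructuredArrow.hom_ext _ _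
        (((Functor.whiskeringLeft _ _ H).obj Q).map_injective
          (hα' ((CostructuredArrow.w m).trans (hpre S).symm)))

/-- If `F` inverts the weak equivalences between cofibrant objects, then it has a left derived
functor, which agrees with `F` on cofibrant objects. -/
lemma exists_isIso_app_of_isIso_map
    (hF : ∀ {X Y : M} (f : X ⟶ Y) [IsCofibrant X] [IsCofibrant Y] [WeakEquivalence f],
      IsIso (F.map f)) :
    ∃ (LF : Ho ⥤ H) (α : Q ⋙ LF ⟶ F), ∀ (X : M) [IsCofibrant X], IsIso (α.app X) := by
  have hp := fun X : M => isIso_map_of_weakEquivalence Q (pResolutionObj X)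
  have hι : (weakEquivalences (CofibrantObject M)).IsInvertedBy (CofibrantObject.ι ⋙ F) :=
    fun X Y f hf => by
      have : WeakEquivalence f := ⟨hf⟩
      exact hF f.hom
  let LF : Ho ⥤ H := Localization.lift (CofibrantObject.ι ⋙ F) hι (CofibrantObject.ι ⋙ Q)
  let e : (CofibrantObject.ι ⋙ Q) ⋙ LF ≅ CofibrantObject.ι ⋙ F := Localization.fac _ _ _
  let e' (X : M) : LF.obj (Q.obj (resolutionObj X)) ≅ F.obj (resolutionObj X) :=
    e.app (CofibrantObject.mk (resolutionObj X))
  have he' {X Y : M} (f : resolutionObj X ⟶ resolutionObj Y) :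
      LF.map (Q.map f) ≫ (e' Y).hom = (e' X).hom ≫ F.map f :=
    e.hom.naturality (CofibrantObject.homMk f)
  refine ⟨LF, {
    app := fun X => inv (LF.map (Q.map (pResolutionObj X))) ≫ (e' X).hom ≫
      F.map (pResolutionObj X)
    naturality := fun X Y f => ?_ }, fun X _ => ?_⟩
  · have h := resolutionMap_fac f
    have h₁ := LF.congr_map (Q.congr_map h)
    have h₂ := F.congr_map h
    simp only [Functor.map_comp, Functor.comp_map] at h₁ h₂ ⊢
    rw [Category.assoc, Category.assoc, ← h₂, IsIso.eq_inv_comp, ← reassoc_of% h₁,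
      IsIso.hom_inv_id_assoc, reassoc_of% he']
  · have := hF (pResolutionObj X)
    dsimp
    infer_instance

/-- A left derived functor of a functor inverting the weak equivalences between cofibrant
objects agrees with it on cofibrant objects. -/
lemma isIso_app_of_isLeftDerivedFunctor
    (hF : ∀ {X Y : M} (f : X ⟶ Y) [IsCofibrant X] [IsCofibrant Y] [WeakEquivalence f],
      IsIso (F.map f))
    {LF : Ho ⥤ H} (α : Q ⋙ LF ⟶ F) [LF.IsLeftDerivedFunctor α (weakEquivalences M)]
    (X : M) [IsCofibrant X] : IsIso (α.app X) := by
  obtain ⟨LF', α', h⟩ := exists_isIso_app_of_isIso_map (Q := Q) hF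
  have := isLeftDerivedFunctor_of_isIso_app α' h
  have h' := Functor.leftDerived_fac_app LF' α' (weakEquivalences M) LF α X
  have h'' : IsIso (LF'.leftDerivedLift α' (weakEquivalences M) LF α) :=
    (Functor.isLeftDerivedFunctor_iff_isIso_leftDerivedLift LF' α' (weakEquivalences M) LF α).1
      inferInstance
  rw [← h']
  infer_instance

end LeftDerived

/-! ### Quillen adjunctions -/

section Quillen

variable {M : Type u₁} [Category.{v} M] [ModelCategory M]
  {N : Type u₂} [Category.{v} N] [ModelCategory N] {F : M ⥤ N} {G : N ⥤ M} {adj : F ⊣ G}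

namespace IsQuillenAdjunction

variable (h : IsQuillenAdjunction adj)
include h

lemma cofibration_map {X Y : M} (f : X ⟶ Y) [Cofibration f] : Cofibration (F.map f) :=
  ⟨h.cofibration f (mem_cofibrations f)⟩

lemma weakEquivalence_map {X Y : M} (f : X ⟶ Y) [Cofibration f] [WeakEquivalence f] :
    WeakEquivalence (F.map f) :=
  ⟨(h.trivialCofibration f (mem_trivialCofibrations f)).2⟩

lemma fibration_map {X Y : N} (p : X ⟶ Y) [Fibration p] : Fibration (G.map p) := by
  rw [fibration_iff, ← trivialCofibrations_rlp]
  intro A B i hi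
  rw [← adj.hasLiftingProperty_iff]
  obtain ⟨_, _⟩ := (mem_trivialCofibrations_iff _).1 (h.trivialCofibration i hi)
  infer_instance

lemma weakEquivalence_map_of_fibration {X Y : N} (p : X ⟶ Y) [Fibration p] [WeakEquivalence p] :
    WeakEquivalence (G.map p) := by
  refine ((mem_trivialFibrations_iff _).1 ?_).2
  rw [← cofibrations_rlp]
  intro A B i hi
  rw [← adj.hasLiftingProperty_iff]
  have : Cofibration (F.map i) := ⟨h.cofibration i hi⟩
  infer_instance

/-- Ken Brown's lemma for a left Quillen functor. -/
lemma weakEquivalence_map_of_isCofibrant {X Y : M} [IsCofibrant X] [IsCofibrant Y]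
    (f : X ⟶ Y) [WeakEquivalence f] : WeakEquivalence (F.map f) := by
  let d : CofibrantBrownFactorization f := Classical.arbitrary _
  have := h.weakEquivalence_map d.i
  have := h.weakEquivalence_map d.s
  have : WeakEquivalence (F.map d.p) :=
    weakEquivalence_of_precomp_of_fac (f := F.map d.s) (g := F.map d.p) (fg := 𝟙 _) (by
      rw [← F.map_comp, d.s_p, F.map_id])
  rw [← d.fac, F.map_comp]
  infer_instance

/-- Ken Brown's lemma for a right Quillen functor. -/
lemma weakEquivalence_map_of_isFibrant {X Y : N} [IsFibrant X] [IsFibrant Y]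
    (f : X ⟶ Y) [WeakEquivalence f] : WeakEquivalence (G.map f) := by
  let d : FibrantBrownFactorization f := Classical.arbitrary _
  have := h.weakEquivalence_map_of_fibration d.p
  have := h.weakEquivalence_map_of_fibration d.r
  have : WeakEquivalence (G.map d.i) :=
    weakEquivalence_of_postcomp_of_fac (f := G.map d.i) (g := G.map d.r) (fg := 𝟙 _) (by
      rw [← G.map_comp, d.i_r, G.map_id])
  rw [← d.fac, G.map_comp]
  infer_instance

end IsQuillenAdjunction

end Quillen

/-! ### The derived adjunction -/

section DerivedAdjunction

variable {M : Type u₁} [Category.{v} M] [ModelCategory M]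
  {N : Type u₂} [Category.{v} N] [ModelCategory N] {F : M ⥤ N} {G : N ⥤ M} {adj : F ⊣ G}

namespace IsQuillenAdjunction

variable (h : IsQuillenAdjunction adj)
  {LF : (weakEquivalences M).Localization ⥤ (weakEquivalences N).Localization}
  {RG : (weakEquivalences N).Localization ⥤ (weakEquivalences M).Localization}
  (α : (weakEquivalences M).Q ⋙ LF ⟶ F ⋙ (weakEquivalences N).Q)
  (β : G ⋙ (weakEquivalences M).Q ⟶ (weakEquivalences N).Q ⋙ RG)

include h

lemma isIso_map_of_isCofibrant {X Y : M} (f : X ⟶ Y) [IsCofibrant X] [IsCofibrant Y]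
    [WeakEquivalence f] : IsIso ((F ⋙ (weakEquivalences N).Q).map f) := by
  have := h.weakEquivalence_map_of_isCofibrant f
  exact isIso_map_of_weakEquivalence (weakEquivalences N).Q (F.map f)

/-- The right adjoint has a right derived functor, computed on fibrant objects. -/
lemma derives_right :
    (FibrantObject.localizerMorphism N).Derives (G ⋙ (weakEquivalences M).Q) := by
  intro X Y f hf
  have : WeakEquivalence f := ⟨hf⟩
  have := h.weakEquivalence_map_of_isFibrant f.hom
  exact isIso_map_of_weakEquivalence (weakEquivalences M).Q (G.map f.hom)

lemma isIso_left_app [LF.IsLeftDerivedFunctor α (weakEquivalences M)] (X : M) [IsCofibrant X] :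
    IsIso (α.app X) :=
  isIso_app_of_isLeftDerivedFunctor (fun f => h.isIso_map_of_isCofibrant f) α X

lemma isIso_right_app [RG.IsRightDerivedFunctor β (weakEquivalences N)] (Y : N) [IsFibrant Y] :
    IsIso (β.app Y) :=
  h.derives_right.isIso_of_isRightDerivedFunctor β (FibrantObject.mk Y)

/-- The total derived functors of a Quillen adjunction are adjoint, compatibly with the given
adjunction: as each of them agrees with the original functor on (co)fibrant objects, it is an
absolute derived functor. -/
lemma exists_derivedAdjunction [LF.IsLeftDerivedFunctor α (weakEquivalences M)]
    [RG.IsRightDerivedFunctor β (weakEquivalences N)] :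
    ∃ A : LF ⊣ RG,
      (∀ X, A.unit.app ((weakEquivalences M).Q.obj X) ≫ RG.map (α.app X) =
        (weakEquivalences M).Q.map (adj.unit.app X) ≫ β.app (F.obj X)) ∧
      ∀ Y, LF.map (β.app Y) ≫ A.counit.app ((weakEquivalences N).Q.obj Y) =
        α.app (G.obj Y) ≫ (weakEquivalences N).Q.map (adj.counit.app Y) := by
  have : (LF ⋙ RG).IsLeftDerivedFunctor
      ((Functor.associator _ _ _).inv ≫ Functor.whiskerRight α RG) (weakEquivalences M) :=
    isLeftDerivedFunctor_of_isIso_app _ (fun X _ => by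
      have := h.isIso_left_app α X
      dsimp
      infer_instance)
  have : (RG ⋙ LF).IsRightDerivedFunctor
      (Functor.whiskerRight β LF ≫ (Functor.associator _ _ _).hom) (weakEquivalences N) := by
    have hd : (FibrantObject.localizerMorphism N).Derives
        ((G ⋙ (weakEquivalences M).Q) ⋙ LF) := fun X Y f hf => by
      have := h.derives_right f hf
      exact inferInstanceAs (IsIso (LF.map
        (((FibrantObject.localizerMorphism N).functor ⋙ G ⋙ (weakEquivalences M).Q).map f)))
    exact LocalizerMorphism.Derives.isRightDerivedFunctor_of_isIso
      (Φ := FibrantObject.localizerMorphism N) hd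
      (Functor.whiskerRight β LF ≫ (Functor.associator _ _ _).hom) (fun Y => by
        have := h.isIso_right_app β Y.obj
        exact inferInstanceAs (IsIso (LF.map (β.app Y.obj) ≫ 𝟙 _)))
  exact ⟨adj.derived (weakEquivalences M) (weakEquivalences N) α β,
    fun X => adj.derivedη_fac_app (weakEquivalences M) α β X,
    fun Y => adj.derivedε_fac_app (weakEquivalences N) α β Y⟩

/-- If the derived functors are equivalences, then a morphism `F X ⟶ Y` with `X` cofibrant and
`Y` fibrant is a weak equivalence if and only if its adjoint is. -/
lemma weakEquivalence_homEquiv_iff [LF.IsLeftDerivedFunctor α (weakEquivalences M)]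
    [RG.IsRightDerivedFunctor β (weakEquivalences N)] [LF.IsEquivalence]
    {X : M} {Y : N} [IsCofibrant X] [IsFibrant Y] (f : F.obj X ⟶ Y) :
    WeakEquivalence (adj.homEquiv X Y f) ↔ WeakEquivalence f := by
  obtain ⟨A, hA, -⟩ := h.exists_derivedAdjunction α β
  have := h.isIso_left_app α X
  have := h.isIso_right_app β Y
  have := A.isEquivalence_right_of_isEquivalence_left
  have e : (weakEquivalences M).Q.map (adj.homEquiv X Y f) ≫ β.app Y =
      A.unit.app _ ≫ RG.map (α.app X) ≫ RG.map ((weakEquivalences N).Q.map f) := by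
    have := β.naturality f
    dsimp at this
    rw [adj.homEquiv_unit, Functor.map_comp, Category.assoc, this, ← reassoc_of% hA]
  rw [← isIso_map_iff_weakEquivalence (weakEquivalences M).Q,
    ← isIso_map_iff_weakEquivalence (weakEquivalences N).Q, ← isIso_comp_right_iff _ (β.app Y), e,
    isIso_comp_left_iff, isIso_comp_left_iff, isIso_iff_of_reflects_iso]

/-- A Quillen adjunction is a Quillen equivalence if the derived counit is a weak equivalence and
every bifibrant object is, up to a weak equivalence, the image of a fibrant object. -/
lemma isQuillenEquivalence
    (hcounit : ∀ (Y : N) [IsFibrant Y], ∃ (P : M) (p : P ⟶ G.obj Y), IsCofibrant P ∧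
      WeakEquivalence p ∧ WeakEquivalence ((adj.homEquiv P Y).symm p))
    (hsurj : ∀ (X : M) [IsCofibrant X] [IsFibrant X], ∃ (Y : N) (f : X ⟶ G.obj Y), IsFibrant Y ∧
      WeakEquivalence f) :
    IsQuillenEquivalence adj where
  isQuillenAdjunction := h
  exists_equivalence := by
    obtain ⟨LF, α, hα⟩ := exists_isIso_app_of_isIso_map (Q := (weakEquivalences M).Q)
      (fun f => h.isIso_map_of_isCofibrant f)
    have := isLeftDerivedFunctor_of_isIso_app α hα
    have := h.derives_right.hasPointwiseRightDerivedFunctor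
    let RG := (G ⋙ (weakEquivalences M).Q).totalRightDerived (weakEquivalences N).Q
      (weakEquivalences N)
    let β : G ⋙ (weakEquivalences M).Q ⟶ (weakEquivalences N).Q ⋙ RG :=
      (G ⋙ (weakEquivalences M).Q).totalRightDerivedUnit (weakEquivalences N).Q
        (weakEquivalences N)
    obtain ⟨A, -, hA⟩ := h.exists_derivedAdjunction α β
    have hM := Localization.essSurj (weakEquivalences M).Q (weakEquivalences M)
    have hN := Localization.essSurj (weakEquivalences N).Q (weakEquivalences N)
    have hcounit' (Y : N) [IsFibrant Y] : IsIso (A.counit.app ((weakEquivalences N).Q.obj Y)) := by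
      obtain ⟨P, p, _, _, _⟩ := hcounit Y
      have := hα P
      have := h.isIso_right_app β Y
      have := isIso_map_of_weakEquivalence (weakEquivalences M).Q p
      have := isIso_map_of_weakEquivalence (weakEquivalences N).Q ((adj.homEquiv P Y).symm p)
      have e : (LF.map ((weakEquivalences M).Q.map p) ≫ LF.map (β.app Y)) ≫ A.counit.app _ =
          α.app P ≫ (weakEquivalences N).Q.map ((adj.homEquiv P Y).symm p) := by
        have := α.naturality p
        dsimp at this
        rw [Category.assoc, hA, adj.homEquiv_counit, Functor.map_comp, reassoc_of% this]
      have : IsIso ((LF.map ((weakEquivalences M).Q.map p) ≫ LF.map (β.app Y)) ≫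
          A.counit.app _) := by
        rw [e]; infer_instance
      exact IsIso.of_isIso_comp_left (LF.map ((weakEquivalences M).Q.map p) ≫ LF.map (β.app Y)) _
    have : IsIso A.counit := by
      refine (NatTrans.isIso_iff_isIso_app _).2 fun Z => ?_
      have := isIso_map_of_weakEquivalence (weakEquivalences N).Q
        (FibrantObject.HoCat.iResolutionObj ((weakEquivalences N).Q.objPreimage Z))
      rw [NatTrans.isIso_app_iff_of_iso A.counit
        (((weakEquivalences N).Q.objObjPreimageIso Z).symm ≪≫
          asIso ((weakEquivalences N).Q.map (FibrantObject.HoCat.iResolutionObj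
            ((weakEquivalences N).Q.objPreimage Z))))]
      exact hcounit' _
    have : RG.Full := A.fullyFaithfulROfIsIsoCounit.full
    have : RG.Faithful := A.fullyFaithfulROfIsIsoCounit.faithful
    have : RG.EssSurj := ⟨fun Z => by
      let X := CofibrantObject.HoCat.resolutionObj ((weakEquivalences M).Q.objPreimage Z)
      let p : X ⟶ _ := CofibrantObject.HoCat.pResolutionObj _
      let i := FibrantObject.HoCat.iResolutionObj X
      have := isCofibrant_of_cofibration i
      obtain ⟨Y, f, _, _⟩ := hsurj (FibrantObject.HoCat.resolutionObj X)
      have := h.isIso_right_app β Y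
      have := isIso_map_of_weakEquivalence (weakEquivalences M).Q p
      have := isIso_map_of_weakEquivalence (weakEquivalences M).Q i
      have := isIso_map_of_weakEquivalence (weakEquivalences M).Q f
      exact ⟨(weakEquivalences N).Q.obj Y,
        ⟨(asIso ((weakEquivalences M).Q.map i ≫ (weakEquivalences M).Q.map f ≫ β.app Y)).symm ≪≫
          asIso ((weakEquivalences M).Q.map p) ≪≫ (weakEquivalences M).Q.objObjPreimageIso Z⟩⟩⟩
    have : RG.IsEquivalence := { }
    have := A.isEquivalence_left_of_isEquivalence_right
    exact ⟨A.toEquivalence, α, β, ‹_›, inferInstanceAs (RG.IsRightDerivedFunctor β _)⟩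

end IsQuillenAdjunction

end DerivedAdjunction

/-! ### Tensors with constant simplicial objects -/

section ConstTensor

variable {C : Type u} [Category.{v} C]

/-- The constant simplicial object. -/
abbrev constObj (A : C) : SimplicialObject C := (SimplicialObject.const C).obj A

/-- The map of constant simplicial objects. -/
abbrev constMap {A B : C} (f : A ⟶ B) : constObj A ⟶ constObj B :=
  (SimplicialObject.const C).map f

variable [HasColimits C]

/-- The map `A ⊗ Δ[n] ⟶ X` that corresponds to a morphism `A ⟶ X_n`. -/
def constTensorDesc {A : C} {X : SimplicialObject C} {n : SimplexCategory}
    (a : A ⟶ X.obj (op n)) : tensorObj (constObj A) (SSet.stdSimplex.{v}.obj n) ⟶ X where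
  app m := Sigma.desc fun k => a ≫ X.map (SSet.stdSimplex.objEquiv k).op
  naturality m m' g := by
    apply Sigma.hom_ext
    intro k
    dsimp only [tensorObj]
    rw [Sigma.ι_desc_assoc, Sigma.ι_desc_assoc, Category.assoc, Sigma.ι_desc, Category.assoc,
      ← X.map_comp]
    exact Category.id_comp _

/-- The inclusion of `A` as the summand of `(A ⊗ Δ[n])_n` indexed by the fundamental simplex. -/
def constTensorι (A : C) (n : SimplexCategory) :
    A ⟶ (tensorObj (constObj A) (SSet.stdSimplex.{v}.obj n)).obj (op n) :=
  Sigma.ι (fun _ : (SSet.stdSimplex.{v}.obj n).obj (op n) => A)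
    (SSet.stdSimplex.objEquiv.symm (𝟙 n))

lemma constTensorι_desc {A : C} {X : SimplicialObject C} {n : SimplexCategory}
    (a : A ⟶ X.obj (op n)) : constTensorι A n ≫ (constTensorDesc a).app (op n) = a := by
  refine (Sigma.ι_desc _ _).trans ?_
  rw [Equiv.apply_symm_apply, op_id, X.map_id, Category.comp_id]

lemma constTensor_hom_ext {A : C} {X : SimplicialObject C} {n : SimplexCategory}
    {φ ψ : tensorObj (constObj A) (SSet.stdSimplex.{v}.obj n) ⟶ X}
    (h : constTensorι A n ≫ φ.app (op n) = constTensorι A n ≫ ψ.app (op n)) : φ = ψ := by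
  have h₀ (m : SimplexCategoryᵒᵖ) (k : (SSet.stdSimplex.{v}.obj n).obj m) :
      constTensorι A n ≫ (tensorObj (constObj A) (SSet.stdSimplex.{v}.obj n)).map
        (SSet.stdSimplex.objEquiv k).op =
      Sigma.ι (fun _ : (SSet.stdSimplex.{v}.obj n).obj m => A) k := by
    refine (Sigma.ι_desc _ _).trans ((Category.id_comp (X := A) _).trans ?_)
    congr 1
    rw [SSet.stdSimplex.map_objEquiv_symm]
    exact (congrArg SSet.stdSimplex.objEquiv.symm (Category.comp_id _)).trans
      (Equiv.symm_apply_apply _ _)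
  have key (χ : tensorObj (constObj A) (SSet.stdSimplex.{v}.obj n) ⟶ X) :
      χ = constTensorDesc (constTensorι A n ≫ χ.app (op n)) := by
    apply NatTrans.ext
    funext m
    apply Sigma.hom_ext
    intro k
    refine Eq.trans ?_ (Sigma.ι_desc (fun k => (constTensorι A n ≫ χ.app (op n)) ≫
      X.map (SSet.stdSimplex.objEquiv k).op) k).symm
    have := constTensorι A n ≫= χ.naturality (SSet.stdSimplex.objEquiv k).op
    rw [Category.assoc, ← this, ← Category.assoc]
    exact congrArg (· ≫ χ.app m) (h₀ m k).symm
  rw [key φ, key ψ, h]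

lemma constTensorι_map {A B : C} (f : A ⟶ B) (n : SimplexCategory) :
    constTensorι A n ≫ (tensorMap (constMap f) (𝟙 (SSet.stdSimplex.{v}.obj n))).app (op n) =
      f ≫ constTensorι B n :=
  Sigma.ι_desc _ _

/-- A morphism has the right lifting property against `f ⊗ Δ[n]`, for `f` a map of constant
objects, only if its `n`th component has the right lifting property against `f`. -/
lemma hasLiftingProperty_app {A B : C} (f : A ⟶ B) {X Y : SimplicialObject C} (p : X ⟶ Y)
    (n : SimplexCategory)
    [HasLiftingProperty (tensorMap (constMap f) (𝟙 (SSet.stdSimplex.{v}.obj n))) p] :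
    HasLiftingProperty f (p.app (op n)) where
  sq_hasLift {a b} sq := by
    have sq' : CommSq (constTensorDesc a)
        (tensorMap (constMap f) (𝟙 (SSet.stdSimplex.{v}.obj n))) p (constTensorDesc b) := ⟨by
      apply constTensor_hom_ext
      rw [NatTrans.comp_app, NatTrans.comp_app, reassoc_of% (constTensorι_desc a),
          reassoc_of% (constTensorι_map f),
        constTensorι_desc, sq.w]⟩
    exact ⟨⟨{
      l := constTensorι B n ≫ sq'.lift.app (op n)
      fac_left := by
        rw [← reassoc_of% (constTensorι_map f), ← NatTrans.comp_app, sq'.fac_left,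
          constTensorι_desc]
      fac_right := by
        rw [Category.assoc, ← NatTrans.comp_app, sq'.fac_right, constTensorι_desc] }⟩⟩

end ConstTensor

/-! ### Tensoring a cofibration with a simplicial set -/

section TensorEmpty

/-- The empty simplicial set. -/
def emptySSet : SSet.{v} := (Functor.const _).obj PEmpty

instance (n : SimplexCategoryᵒᵖ) : IsEmpty (emptySSet.{v}.obj n) :=
  inferInstanceAs (IsEmpty PEmpty)

/-- The map from the empty simplicial set. -/
def emptySSetTo (K : SSet.{v}) : emptySSet ⟶ K where
  app n := ↾fun k => isEmptyElim k
  naturality _ _ _ := by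
    ext k
    exact isEmptyElim k

instance (K : SSet.{v}) : Mono (emptySSetTo K) := by
  have (n : SimplexCategoryᵒᵖ) : Mono ((emptySSetTo K).app n) := by
    rw [CategoryTheory.mono_iff_injective]
    intro k
    exact isEmptyElim k
  exact NatTrans.mono_of_mono_app _

variable {C : Type u} [Category.{v} C] [HasColimits C]

/-- The tensor with the empty simplicial set is initial. -/
def isInitialTensorEmpty (X : SimplicialObject C) : IsInitial (tensorObj X emptySSet.{v}) :=
  IsInitial.ofUniqueHom
    (fun Y =>
      { app := fun n => Sigma.desc fun k => isEmptyElim k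
        naturality := fun n m g => by
          apply Sigma.hom_ext
          intro k
          exact isEmptyElim k })
    (fun Y φ => by
      apply NatTrans.ext
      funext n
      apply Sigma.hom_ext
      intro k
      exact isEmptyElim k)

namespace IsSimplicialModelStructure

variable {X Y : SimplicialObject C} (f : X ⟶ Y) (K : SSet.{v})

lemma isIso_pushout_inl : IsIso (pushout.inl (tensorMap (𝟙 X) (emptySSetTo K))
    (tensorMap f (𝟙 emptySSet.{v}))) := by
  have : IsIso (tensorMap f (𝟙 emptySSet.{v})) :=
    ⟨(isInitialTensorEmpty Y).to _, (isInitialTensorEmpty X).hom_ext _ _,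
      (isInitialTensorEmpty Y).hom_ext _ _⟩
  infer_instance

lemma tensorMap_eq : tensorMap f (𝟙 K) = pushout.inl (tensorMap (𝟙 X) (emptySSetTo K))
    (tensorMap f (𝟙 emptySSet.{v})) ≫ pushoutProduct f (emptySSetTo K) :=
  (pushout.inl_desc _ _ _).symm

variable [ModelCategory (SimplicialObject C)] (h : IsSimplicialModelStructure C)
include h

/-- Axiom SM7 for the inclusion of the empty simplicial set in `K`. -/
lemma cofibration_tensorMap [Cofibration f] : Cofibration (tensorMap f (𝟙 K)) := by
  have := isIso_pushout_inl f K
  have : Cofibration (pushoutProduct f (emptySSetTo K)) :=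
    ⟨h.cofibration f _ (mem_cofibrations f) inferInstance⟩
  rw [tensorMap_eq]
  infer_instance

lemma weakEquivalence_tensorMap [Cofibration f] [WeakEquivalence f] :
    WeakEquivalence (tensorMap f (𝟙 K)) := by
  have := isIso_pushout_inl f K
  have : WeakEquivalence (pushoutProduct f (emptySSetTo K)) :=
    ⟨h.weakEquivalence_left f _ (mem_cofibrations f) inferInstance (mem_weakEquivalences f)⟩
  rw [tensorMap_eq]
  infer_instance

end IsSimplicialModelStructure

end TensorEmpty

/-! ### Constant simplicial objects are Reedy cofibrant -/

section Const

variable {C : Type u} [Category.{v} C] [HasColimits C]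

instance : IsEmpty (LatchingIndex 0) := ⟨fun a => Nat.not_lt_zero _ a.property⟩

/-- The latching index given by the map `[n] ⟶ [0]`, for `0 < n`. -/
def latchingIndexZero (n : ℕ) (hn : 0 < n) : LatchingIndex n :=
  ⟨Over.mk (Y := op ⦋0⦌) (SimplexCategory.const ⦋n⦌ ⦋0⦌ 0).op, hn⟩

/-- The latching index given by `[n] ⟶ [0]` maps to every latching index. -/
def latchingIndexZeroTo (n : ℕ) (hn : 0 < n) (a : LatchingIndex n) : latchingIndexZero n hn ⟶ a :=
  ObjectProperty.homMk (Over.homMk (SimplexCategory.const a.obj.left.unop ⦋0⦌ 0).op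
    (Quiver.Hom.unop_inj (by ext : 3; exact Subsingleton.elim (α := Fin 1) _ _)))

lemma ι_latchingMap (X : SimplicialObject C) (n : ℕ) (a : LatchingIndex n) :
    colimit.ι (latchingForget n ⋙ X) a ≫ latchingMap X n = X.map a.obj.hom :=
  colimit.ι_desc _ _

lemma ι_latchingObjMap {X Y : SimplicialObject C} (f : X ⟶ Y) (n : ℕ) (a : LatchingIndex n) :
    colimit.ι (latchingForget n ⋙ X) a ≫ latchingObjMap f n =
      f.app a.obj.left ≫ colimit.ι (latchingForget n ⋙ Y) a :=
  ι_colimMap _ _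

lemma latchingMap_const_comp (A : C) (n : ℕ) (hn : 0 < n) :
    latchingMap (constObj A) n ≫
      colimit.ι (latchingForget n ⋙ constObj A) (latchingIndexZero n hn) = 𝟙 _ := by
  apply colimit.hom_ext
  intro a
  have h : (show A ⟶ latchingObj (constObj A) n from colimit.ι (latchingForget n ⋙ constObj A) a) =
      colimit.ι (latchingForget n ⋙ constObj A) (latchingIndexZero n hn) :=
    (Category.id_comp (X := A) _).symm.trans
      (colimit.w (latchingForget n ⋙ constObj A) (latchingIndexZeroTo n hn a))
  rw [Category.comp_id, reassoc_of% (ι_latchingMap (constObj A) n a)]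
  exact (Category.id_comp (X := A) _).trans h.symm

/-- In degree `0` the relative latching map of a map of constant objects is the given map, and in
positive degrees it is an isomorphism. -/
lemma isReedyCofibration_constMap [ModelCategory C] {A B : C} (f : A ⟶ B) [Cofibration f] :
    IsReedyCofibration (constMap f) := by
  intro n
  rw [← trivialFibrations_llp]
  intro E F p hp
  obtain ⟨_, _⟩ := (mem_trivialFibrations_iff p).1 hp
  refine ⟨fun {u w} sq => ?_⟩
  rcases Nat.eq_zero_or_pos n with rfl | hn
  · have sq' : CommSq (pushout.inl (latchingMap (constObj A) 0) (latchingObjMap (constMap f) 0) ≫ u)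
        f p w := ⟨by
      rw [Category.assoc, sq.w]
      exact (Category.assoc _ _ _).symm.trans (congrArg (· ≫ w) (pushout.inl_desc _ _ _))⟩
    refine ⟨⟨{ l := sq'.lift, fac_left := ?_, fac_right := sq'.fac_right }⟩⟩
    apply pushout.hom_ext
    · exact (Category.assoc _ _ _).symm.trans ((congrArg (· ≫ sq'.lift)
        (pushout.inl_desc _ _ _)).trans sq'.fac_left)
    · apply colimit.hom_ext
      intro a
      exact isEmptyElim a
  · let s (A : C) := colimit.ι (latchingForget n ⋙ constObj A) (latchingIndexZero n hn)
    have hs (A : C) : s A ≫ latchingMap (constObj A) n = 𝟙 A := ι_latchingMap _ _ _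
    have hs' (A : C) : latchingMap (constObj A) n ≫ s A = 𝟙 _ := latchingMap_const_comp A n hn
    have hf : f ≫ s B = s A ≫ latchingObjMap (constMap f) n  :=
      (ι_latchingObjMap (constMap f) n _).symm
    have hinl : pushout.inl _ _ ≫ relativeLatchingMap (constMap f) n = f := pushout.inl_desc _ _ _
    have hinr : pushout.inr _ _ ≫ relativeLatchingMap (constMap f) n =
      latchingMap (constObj B) n := pushout.inr_desc _ _ _
    refine ⟨⟨{ l := s B ≫ pushout.inr _ _ ≫ u, fac_left := ?_, fac_right := ?_ }⟩⟩
    · apply pushout.hom_ext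
      · rw [reassoc_of% hinl, reassoc_of% hf, ← pushout.condition_assoc, reassoc_of% (hs A)]
        exact Category.id_comp (X := A) _
      · rw [reassoc_of% hinr, reassoc_of% (hs' B)]
    · rw [Category.assoc, Category.assoc, sq.w, reassoc_of% hinr, reassoc_of% (hs B)]
      exact Category.id_comp (X := B) _

end Const

/-! ### Fibrations of the canonical model structure -/

section Canonical

variable {C : Type u} [Category.{v} C] [HasLimits C] [HasColimits C] [ModelCategory C]
  [ModelCategory (SimplicialObject C)]

namespace IsCanonicalModelStructure

variable (hC : IsCanonicalModelStructure C)
include hC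

lemma cofibration_constMap {A B : C} (f : A ⟶ B) [Cofibration f] : Cofibration (constMap f) :=
  ⟨(hC.cofibration_iff _).2 (isReedyCofibration_constMap f)⟩

lemma weakEquivalence_constMap {A B : C} (f : A ⟶ B) [WeakEquivalence f] :
    WeakEquivalence (constMap f) :=
  ⟨hC.weakEquivalence_of_level _ fun _ => mem_weakEquivalences f⟩

variable (hC' : IsSimplicialModelStructure C)
include hC'

/-- Fibrations are level fibrations, as `i ⊗ Δ[n]` is a trivial cofibration for every trivial
cofibration `i` between constant objects. -/
lemma fibration_app {X Y : SimplicialObject C} (p : X ⟶ Y) [Fibration p] (n : SimplexCategory) :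
    Fibration (p.app (op n)) := by
  constructor
  rw [← trivialCofibrations_rlp]
  intro A B f hf
  obtain ⟨_, _⟩ := (mem_trivialCofibrations_iff f).1 hf
  have := hC.cofibration_constMap f
  have := hC.weakEquivalence_constMap f
  have := hC'.cofibration_tensorMap (constMap f) (SSet.stdSimplex.{v}.obj n)
  have := hC'.weakEquivalence_tensorMap (constMap f) (SSet.stdSimplex.{v}.obj n)
  exact hasLiftingProperty_app f p n

lemma fibration_weakEquivalence_app {X Y : SimplicialObject C} (p : X ⟶ Y) [Fibration p]
    [WeakEquivalence p] (n : SimplexCategory) :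
    Fibration (p.app (op n)) ∧ WeakEquivalence (p.app (op n)) := by
  rw [← mem_trivialFibrations_iff, ← cofibrations_rlp]
  intro A B f hf
  have : Cofibration f := ⟨hf⟩
  have := hC.cofibration_constMap f
  have := hC'.cofibration_tensorMap (constMap f) (SSet.stdSimplex.{v}.obj n)
  exact hasLiftingProperty_app f p n

lemma weakEquivalence_app_of_fibration {X Y : SimplicialObject C} (p : X ⟶ Y) [Fibration p]
    [WeakEquivalence p] (n : SimplexCategory) : WeakEquivalence (p.app (op n)) :=
  (hC.fibration_weakEquivalence_app hC' p n).2

lemma isFibrant_obj (X : SimplicialObject C) [IsFibrant X] (n : SimplexCategory) :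
    IsFibrant (X.obj (op n)) := by
  have := hC.fibration_app hC' (terminal.from X) n
  have ht : IsTerminal ((⊤_ (SimplicialObject C)).obj (op n)) :=
    IsTerminal.isTerminalObj ((evaluation SimplexCategoryᵒᵖ C).obj (op n)) _ terminalIsTerminal
  exact (isFibrant_iff_of_isTerminal ((terminal.from X).app (op n)) ht).2 this

end IsCanonicalModelStructure

end Canonical

/-! ### Factorizations in the simplex category -/

section Simplex

lemma exists_epi_mono_fac {i j : SimplexCategory} (g : i ⟶ j) :
    ∃ (l : SimplexCategory) (e : i ⟶ l) (m : l ⟶ j),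
      Epi e ∧ Mono m ∧ e ≫ m = g ∧ l.len ≤ i.len ∧ l.len ≤ j.len :=
  ⟨image g, factorThruImage g, image.ι g, inferInstance, inferInstance, image.fac g,
    SimplexCategory.len_le_of_epi (factorThruImage g), SimplexCategory.len_le_of_mono (image.ι g)⟩

/-- An endomorphism of `[k]` other than the identity factors through some `[l]` with `l < k`. -/
lemma eq_id_or_exists_fac {k : SimplexCategory} (g : k ⟶ k) :
    g = 𝟙 k ∨ ∃ (l : SimplexCategory) (a : k ⟶ l) (b : l ⟶ k), a ≫ b = g ∧ l.len < k.len := by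
  obtain ⟨l, e, m, he, hm, rfl, hl, -⟩ := exists_epi_mono_fac g
  rcases hl.lt_or_eq with hl | hl
  · exact Or.inr ⟨l, e, m, rfl, hl⟩
  · obtain rfl : l = k := SimplexCategory.ext hl
    exact Or.inl (by rw [SimplexCategory.eq_id_of_epi e, SimplexCategory.eq_id_of_mono m,
      Category.comp_id])

/-- Two factorizations `a ≫ b = a' ≫ b'` are connected: there are `e ≫ m = a` and `e' ≫ m' = b'`
such that the square with sides `e` and `m'` has a diagonal filler. -/
lemma exists_diagonal {i j l l' : SimplexCategory} {a : i ⟶ l} {b : l ⟶ j} {a' : i ⟶ l'}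
    {b' : l' ⟶ j} (h : a ≫ b = a' ≫ b') :
    ∃ (p q : SimplexCategory) (e : i ⟶ p) (m : p ⟶ l) (e' : l' ⟶ q) (m' : q ⟶ j) (t : p ⟶ q),
      p.len ≤ l.len ∧ q.len ≤ l'.len ∧ e ≫ m = a ∧ e' ≫ m' = b' ∧ e ≫ t = a' ≫ e' ∧
        t ≫ m' = m ≫ b := by
  obtain ⟨p, e, m, he, hm, rfl, -, hp⟩ := exists_epi_mono_fac a
  obtain ⟨q, e', m', he', hm', rfl, hq, -⟩ := exists_epi_mono_fac b'
  have := isSplitEpi_of_epi e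
  have ht : (section_ e ≫ a' ≫ e') ≫ m' = m ≫ b := by
    rw [Category.assoc, Category.assoc, ← h, Category.assoc, IsSplitEpi.id_assoc]
  refine ⟨p, q, e, m, e', m', section_ e ≫ a' ≫ e', hp, hq, rfl, rfl, ?_, ht⟩
  rw [← cancel_mono m', Category.assoc, ht, Category.assoc, ← h, Category.assoc]

end Simplex

/-! ### Latching objects through operators -/

section Latching

variable {C : Type u} [Category.{v} C] [HasColimits C]

/-- The map `X_j ⟶ L_k X` given by an operator `[k] ⟶ [j]` with `j < k`. -/
def latchingι (X : SimplicialObject C) {k : ℕ} {j : SimplexCategory} (τ : ⦋k⦌ ⟶ j)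
    (hj : j.len < k) : X.obj (op j) ⟶ latchingObj X k :=
  colimit.ι (latchingForget k ⋙ X) ⟨Over.mk (X := op ⦋k⦌) (Y := op j) τ.op, hj⟩

lemma latchingObj_hom_ext {X : SimplicialObject C} {k : ℕ} {E : C} {u w : latchingObj X k ⟶ E}
    (h : ∀ (j : SimplexCategory) (τ : ⦋k⦌ ⟶ j) (hj : j.len < k),
      latchingι X τ hj ≫ u = latchingι X τ hj ≫ w) : u = w :=
  colimit.hom_ext fun a => h a.obj.left.unop a.obj.hom.unop a.property

lemma latchingι_latchingMap (X : SimplicialObject C) {k : ℕ} {j : SimplexCategory} (τ : ⦋k⦌ ⟶ j)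
    (hj : j.len < k) : latchingι X τ hj ≫ latchingMap X k = X.map τ.op :=
  ι_latchingMap _ _ _

lemma latchingι_latchingObjMap {X Y : SimplicialObject C} (f : X ⟶ Y) {k : ℕ}
    {j : SimplexCategory} (τ : ⦋k⦌ ⟶ j) (hj : j.len < k) :
    latchingι X τ hj ≫ latchingObjMap f k = f.app (op j) ≫ latchingι Y τ hj :=
  ι_latchingObjMap _ _ _

lemma map_latchingι (X : SimplicialObject C) {k : ℕ} {i j : SimplexCategory} (σ : ⦋k⦌ ⟶ j)
    (τ : j ⟶ i) (hj : j.len < k) (hi : i.len < k) :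
    X.map τ.op ≫ latchingι X σ hj = latchingι X (σ ≫ τ) hi := by
  let g : (⟨Over.mk (X := op ⦋k⦌) (Y := op i) (σ ≫ τ).op, hi⟩ : LatchingIndex k) ⟶
      ⟨Over.mk (X := op ⦋k⦌) (Y := op j) σ.op, hj⟩ := ObjectProperty.homMk (Over.homMk τ.op)
  exact colimit.w (latchingForget k ⋙ X) g

/-- Morphisms out of the latching object are compatible families indexed by operators. -/
lemma exists_latchingObj_desc {X : SimplicialObject C} {k : ℕ} {E : C}
    (h : ∀ (j : SimplexCategory), (⦋k⦌ ⟶ j) → j.len < k → (X.obj (op j) ⟶ E))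
    (comp : ∀ {i j : SimplexCategory} (σ : ⦋k⦌ ⟶ j) (τ : j ⟶ i) (hj : j.len < k) (hi : i.len < k),
      X.map τ.op ≫ h j σ hj = h i (σ ≫ τ) hi) :
    ∃ u : latchingObj X k ⟶ E, ∀ (j : SimplexCategory) (τ : ⦋k⦌ ⟶ j) (hj : j.len < k),
      latchingι X τ hj ≫ u = h j τ hj := by
  let c : Cocone (latchingForget k ⋙ X) :=
    { pt := E
      ι :=
        { app := fun a => h a.obj.left.unop a.obj.hom.unop a.property
          naturality := fun a b g => by
            have hw : b.obj.hom.unop ≫ g.hom.left.unop = a.obj.hom.unop :=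
              congrArg Quiver.Hom.unop (Over.w g.hom)
            refine (comp _ g.hom.left.unop b.property a.property).trans
              (Eq.trans ?_ (Category.comp_id _).symm)
            rw [hw] } }
  exact ⟨colimit.desc _ c, fun j τ hj => colimit.ι_desc _ _⟩

end Latching

/-! ### Reedy cofibrations are level cofibrations -/

section LevelCofibration

variable {C : Type u} [Category.{v} C]

section

variable {X Y : SimplicialObject C} (f : X ⟶ Y) {E F : C} (p : E ⟶ F) {n : SimplexCategory}
  (x : X.obj (op n) ⟶ E) (y : Y.obj (op n) ⟶ F)

/-- A solution of a lifting problem of `f_n` against `p` on the part of `Y_n` that comes from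
degrees less than `k`: a compatible family of morphisms `Y_j ⟶ E`, indexed by the operators
`[n] ⟶ [j]` with `j < k`. -/
structure PartialLift (k : ℕ) where
  hom (j : SimplexCategory) (σ : n ⟶ j) : j.len < k → (Y.obj (op j) ⟶ E)
  comp_hom {i j : SimplexCategory} (σ : n ⟶ j) (τ : j ⟶ i) (hj : j.len < k) (hi : i.len < k) :
    Y.map τ.op ≫ hom j σ hj = hom i (σ ≫ τ) hi
  fac_left (j : SimplexCategory) (σ : n ⟶ j) (hj : j.len < k) :
    f.app (op j) ≫ hom j σ hj = X.map σ.op ≫ x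
  fac_right (j : SimplexCategory) (σ : n ⟶ j) (hj : j.len < k) :
    hom j σ hj ≫ p = Y.map σ.op ≫ y

variable {f p x y}

/-- The extension of a partial lift to an operator that factors through lower degrees does not
depend on the factorization. -/
lemma PartialLift.map_comp_hom_eq {k : ℕ} (h : PartialLift f p x y k) {j l l' : SimplexCategory}
    {a : n ⟶ l} {b : l ⟶ j} {a' : n ⟶ l'} {b' : l' ⟶ j} (hab : a ≫ b = a' ≫ b')
    (hl : l.len < k) (hl' : l'.len < k) :
    Y.map b.op ≫ h.hom l a hl = Y.map b'.op ≫ h.hom l' a' hl' := by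
  obtain ⟨q, r, e, m, e', m', t, hq, hr, rfl, rfl, het, htm⟩ := exists_diagonal hab
  have hq' := hq.trans_lt hl
  have hr' := hr.trans_lt hl'
  rw [← h.comp_hom e m hq' hl, ← Category.assoc, ← Y.map_comp, ← op_comp, ← htm, op_comp,
    Y.map_comp, Category.assoc, h.comp_hom e t hq' hr', op_comp, Y.map_comp, Category.assoc,
    h.comp_hom a' e' hl' hr']
  congr 2

open Classical in
/-- A partial lift in degrees less than `k` extends to degree `k`: on operators that factor
through lower degrees the extension is forced, and on the others it is a solution of a lifting
problem of the relative latching map. -/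
lemma PartialLift.nonempty_succ [HasColimits C] {k : ℕ} (h : PartialLift f p x y k)
    (hxy : x ≫ p = f.app (op n) ≫ y) [HasLiftingProperty (relativeLatchingMap f k) p] :
    Nonempty (PartialLift f p x y (k + 1)) := by
  have hex (σ : n ⟶ ⦋k⦌) : ∃ l : Y _⦋k⦌ ⟶ E, f.app (op ⦋k⦌) ≫ l = X.map σ.op ≫ x ∧
      l ≫ p = Y.map σ.op ≫ y ∧ ∀ (i : SimplexCategory) (τ : ⦋k⦌ ⟶ i) (hi : i.len < k),
        Y.map τ.op ≫ l = h.hom i (σ ≫ τ) hi := by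
    obtain ⟨d, hd⟩ := exists_latchingObj_desc (X := Y) (fun j τ hj => h.hom j (σ ≫ τ) hj)
      (fun τ τ' hj hi => by rw [h.comp_hom _ τ' hj hi, Category.assoc])
    have w : latchingMap X k ≫ X.map σ.op ≫ x = latchingObjMap f k ≫ d := by
      apply latchingObj_hom_ext
      intro j τ hj
      rw [reassoc_of% (latchingι_latchingMap X τ hj), reassoc_of% (latchingι_latchingObjMap f τ hj),
        hd, h.fac_left, op_comp, X.map_comp, Category.assoc]
    have hinl : pushout.inl _ _ ≫ relativeLatchingMap f k = f.app (op ⦋k⦌) :=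
      pushout.inl_desc _ _ _
    have hinr : pushout.inr _ _ ≫ relativeLatchingMap f k = latchingMap Y k :=
      pushout.inr_desc _ _ _
    have sq : CommSq (pushout.desc _ _ w) (relativeLatchingMap f k) p (Y.map σ.op ≫ y) := ⟨by
      apply pushout.hom_ext
      · rw [pushout.inl_desc_assoc, reassoc_of% hinl, Category.assoc, hxy, ← Category.assoc,
          ← Category.assoc, f.naturality]
      · rw [pushout.inr_desc_assoc, reassoc_of% hinr]
        apply latchingObj_hom_ext
        intro j τ hj
        rw [reassoc_of% (hd j τ hj), h.fac_right, reassoc_of% (latchingι_latchingMap Y τ hj),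
          op_comp, Y.map_comp, Category.assoc]⟩
    refine ⟨sq.lift, ?_, sq.fac_right, fun i τ hi => ?_⟩
    · rw [← hinl, Category.assoc, sq.fac_left, pushout.inl_desc]
    · rw [← latchingι_latchingMap Y τ hi, ← hinr, Category.assoc, Category.assoc, sq.fac_left,
        pushout.inr_desc, hd]
  choose l hl₁ hl₂ hl₃ using hex
  let P (j : SimplexCategory) (σ : n ⟶ j) : Prop :=
    ∃ (i : SimplexCategory) (a : n ⟶ i) (b : i ⟶ j), a ≫ b = σ ∧ i.len < k
  have hlt {j : SimplexCategory} (σ : n ⟶ j) (hj : j.len < k + 1) (hσ : ¬ P j σ) : j = ⦋k⦌ :=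
    SimplexCategory.ext ((Nat.lt_succ_iff_lt_or_eq.1 hj).resolve_left
      fun hj' => hσ ⟨j, σ, 𝟙 j, Category.comp_id _, hj'⟩)
  let H (j : SimplexCategory) (σ : n ⟶ j) (hj : j.len < k + 1) : Y.obj (op j) ⟶ E :=
    if hσ : P j σ then
      Y.map hσ.choose_spec.choose_spec.choose.op ≫ h.hom _ hσ.choose_spec.choose
        hσ.choose_spec.choose_spec.choose_spec.2
    else Y.map (eqToHom (hlt σ hj hσ).symm).op ≫ l (σ ≫ eqToHom (hlt σ hj hσ))
  have H₁ {i j : SimplexCategory} (a : n ⟶ i) (b : i ⟶ j) (hi : i.len < k) (hj : j.len < k + 1) :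
      H j (a ≫ b) hj = Y.map b.op ≫ h.hom i a hi := by
    have hσ : P j (a ≫ b) := ⟨i, a, b, rfl, hi⟩
    exact (dif_pos hσ).trans
      (h.map_comp_hom_eq hσ.choose_spec.choose_spec.choose_spec.1 _ hi)
  have H₂ (σ : n ⟶ ⦋k⦌) (hσ : ¬ P _ σ) : H _ σ (Nat.lt_succ_self k) = l σ := by
    refine (dif_neg hσ).trans ?_
    rw [eqToHom_refl, Category.comp_id, op_id, Y.map_id]
    exact Category.id_comp _
  refine ⟨{ hom := H, comp_hom := ?_, fac_left := ?_, fac_right := ?_ }⟩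
  · intro i j σ τ hj hi
    by_cases hσ : P j σ
    · obtain ⟨q, a, b, rfl, hq⟩ := hσ
      have e : (a ≫ b) ≫ τ = a ≫ b ≫ τ := Category.assoc _ _ _
      rw [e, H₁ a _ hq hj, H₁ a _ hq hi, op_comp, Y.map_comp, Category.assoc]
    · obtain rfl := hlt σ hj hσ
      rw [H₂ σ hσ]
      rcases Nat.lt_succ_iff_lt_or_eq.1 hi with hi' | hi'
      · have e : σ ≫ τ = (σ ≫ τ) ≫ 𝟙 i := (Category.comp_id _).symm
        rw [e, H₁ _ _ hi' hi, hl₃ σ i τ hi', op_id, Y.map_id]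
        exact (Category.id_comp _).symm
      · obtain rfl : i = ⦋k⦌ := SimplexCategory.ext hi'
        rcases eq_id_or_exists_fac τ with rfl | ⟨q, a, b, rfl, hq⟩
        · have e : σ ≫ 𝟙 _ = σ := Category.comp_id _
          rw [e, H₂ σ hσ, op_id, Y.map_id]
          exact Category.id_comp _
        · have e : σ ≫ a ≫ b = (σ ≫ a) ≫ b := (Category.assoc _ _ _).symm
          rw [e, H₁ _ _ hq hi, op_comp, Y.map_comp, Category.assoc, hl₃ σ q a hq]
  · intro j σ hj
    by_cases hσ : P j σ
    · obtain ⟨q, a, b, rfl, hq⟩ := hσ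
      rw [H₁ a b hq hj, op_comp, X.map_comp, Category.assoc, ← h.fac_left q a hq,
        ← Category.assoc, ← Category.assoc, f.naturality]
    · obtain rfl := hlt σ hj hσ
      rw [H₂ σ hσ, hl₁]
  · intro j σ hj
    by_cases hσ : P j σ
    · obtain ⟨q, a, b, rfl, hq⟩ := hσ
      rw [H₁ a b hq hj, op_comp, Y.map_comp, Category.assoc, Category.assoc, h.fac_right q a hq]
    · obtain rfl := hlt σ hj hσ
      rw [H₂ σ hσ, hl₂]

lemma PartialLift.nonempty [HasColimits C] (hxy : x ≫ p = f.app (op n) ≫ y)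
    (hf : ∀ k, HasLiftingProperty (relativeLatchingMap f k) p) (k : ℕ) :
    Nonempty (PartialLift f p x y k) := by
  induction k with
  | zero =>
    exact ⟨{
      hom := fun j _ hj => (Nat.not_lt_zero _ hj).elim
      comp_hom := fun _ _ hj => (Nat.not_lt_zero _ hj).elim
      fac_left := fun _ _ hj => (Nat.not_lt_zero _ hj).elim
      fac_right := fun _ _ hj => (Nat.not_lt_zero _ hj).elim }⟩
  | succ k ih =>
    have := hf k
    exact ih.elim fun h => h.nonempty_succ hxy

end

/-- A partial lift in degrees at most `n`, evaluated at the identity of `[n]`, is a lift. -/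
lemma hasLiftingProperty_app_of_relativeLatchingMap [HasColimits C] {X Y : SimplicialObject C}
    (f : X ⟶ Y) {E F : C} (p : E ⟶ F) (hf : ∀ k, HasLiftingProperty (relativeLatchingMap f k) p)
    (n : SimplexCategory) : HasLiftingProperty (f.app (op n)) p where
  sq_hasLift {x y} sq := by
    obtain ⟨h⟩ := PartialLift.nonempty sq.w hf (n.len + 1)
    refine ⟨⟨{ l := h.hom n (𝟙 n) (Nat.lt_succ_self _), fac_left := ?_, fac_right := ?_ }⟩⟩
    · rw [h.fac_left, op_id, X.map_id]
      exact Category.id_comp _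
    · rw [h.fac_right, op_id, Y.map_id]
      exact Category.id_comp _

variable [HasColimits C] [ModelCategory C]

lemma IsReedyCofibration.cofibration_app {X Y : SimplicialObject C} {f : X ⟶ Y}
    (hf : IsReedyCofibration f) (n : SimplexCategory) : Cofibration (f.app (op n)) := by
  constructor
  rw [← trivialFibrations_llp]
  intro E F p hp
  obtain ⟨_, _⟩ := (mem_trivialFibrations_iff p).1 hp
  refine hasLiftingProperty_app_of_relativeLatchingMap f p (fun k => ?_) n
  have : Cofibration (relativeLatchingMap f k) := ⟨hf k⟩
  infer_instance

lemma IsCanonicalModelStructure.isCofibrant_obj [HasLimits C] [ModelCategory (SimplicialObject C)]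
    (hC : IsCanonicalModelStructure C) (X : SimplicialObject C) [IsCofibrant X]
    (n : SimplexCategory) : IsCofibrant (X.obj (op n)) := by
  have := ((hC.cofibration_iff _).1 (mem_cofibrations (initial.to X))).cofibration_app n
  have ht : IsInitial ((⊥_ (SimplicialObject C)).obj (op n)) :=
    IsInitial.isInitialObj ((evaluation SimplexCategoryᵒᵖ C).obj (op n)) _ initialIsInitial
  exact (isCofibrant_iff_of_isInitial ((initial.to X).app (op n)) ht).2 this

end LevelCofibration

/-! ### Matching objects through operators -/

section Matching

variable {C : Type u} [Category.{v} C] [HasLimits C]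

/-- The map `M_k X ⟶ X_j` given by an operator `[j] ⟶ [k]` with `j < k`. -/
def matchingπ (X : SimplicialObject C) {k : ℕ} {j : SimplexCategory} (τ : j ⟶ ⦋k⦌)
    (hj : j.len < k) : matchingObj X k ⟶ X.obj (op j) :=
  limit.π (matchingForget k ⋙ X) ⟨Under.mk (X := op ⦋k⦌) (Y := op j) τ.op, hj⟩

lemma matchingObj_hom_ext {X : SimplicialObject C} {k : ℕ} {E : C} {u w : E ⟶ matchingObj X k}
    (h : ∀ (j : SimplexCategory) (τ : j ⟶ ⦋k⦌) (hj : j.len < k),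
      u ≫ matchingπ X τ hj = w ≫ matchingπ X τ hj) : u = w :=
  limit.hom_ext fun a => h a.obj.right.unop a.obj.hom.unop a.property

lemma matchingMap_matchingπ (X : SimplicialObject C) {k : ℕ} {j : SimplexCategory} (τ : j ⟶ ⦋k⦌)
    (hj : j.len < k) : matchingMap X k ≫ matchingπ X τ hj = X.map τ.op :=
  limit.lift_π _ _

lemma matchingπ_map (X : SimplicialObject C) {k : ℕ} {i j : SimplexCategory} (τ : j ⟶ ⦋k⦌)
    (ρ : i ⟶ j) (hj : j.len < k) (hi : i.len < k) :
    matchingπ X τ hj ≫ X.map ρ.op = matchingπ X (ρ ≫ τ) hi :=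
  limit.w (matchingForget k ⋙ X) (j := ⟨Under.mk (X := op ⦋k⦌) (Y := op j) τ.op, hj⟩)
    (j' := ⟨Under.mk (X := op ⦋k⦌) (Y := op i) (ρ ≫ τ).op, hi⟩)
    (ObjectProperty.homMk (Under.homMk ρ.op))

/-- Morphisms into the matching object are compatible families indexed by operators. -/
lemma exists_matchingObj_lift {X : SimplicialObject C} {k : ℕ} {E : C}
    (h : ∀ (j : SimplexCategory), (j ⟶ ⦋k⦌) → j.len < k → (E ⟶ X.obj (op j)))
    (comp : ∀ {i j : SimplexCategory} (τ : j ⟶ ⦋k⦌) (ρ : i ⟶ j) (hj : j.len < k) (hi : i.len < k),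
      h j τ hj ≫ X.map ρ.op = h i (ρ ≫ τ) hi) :
    ∃ u : E ⟶ matchingObj X k, ∀ (j : SimplexCategory) (τ : j ⟶ ⦋k⦌) (hj : j.len < k),
      u ≫ matchingπ X τ hj = h j τ hj := by
  let c : Cone (matchingForget k ⋙ X) :=
    { pt := E
      π :=
        { app := fun a => h a.obj.right.unop a.obj.hom.unop a.property
          naturality := fun a b g => by
            have hw : g.hom.right.unop ≫ a.obj.hom.unop = b.obj.hom.unop :=
              congrArg Quiver.Hom.unop (Under.w g.hom)
            refine (Category.id_comp _).trans (Eq.trans ?_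
              (comp _ g.hom.right.unop a.property b.property).symm)
            rw [hw] } }
  exact ⟨limit.lift _ c, fun j τ hj => limit.lift_π _ _⟩

/-- The lifting property against a matching map, in terms of operators. -/
lemma hasLiftingProperty_matchingMap_iff {A B : C} (i : A ⟶ B) (X : SimplicialObject C) (k : ℕ) :
    HasLiftingProperty i (matchingMap X k) ↔
      ∀ (a : A ⟶ X _⦋k⦌)
        (b : ∀ (j : SimplexCategory), (j ⟶ ⦋k⦌) → j.len < k → (B ⟶ X.obj (op j))),
        (∀ {i j : SimplexCategory} (τ : j ⟶ ⦋k⦌) (ρ : i ⟶ j) (hj : j.len < k) (hi : i.len < k),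
          b j τ hj ≫ X.map ρ.op = b i (ρ ≫ τ) hi) →
        (∀ (j : SimplexCategory) (τ : j ⟶ ⦋k⦌) (hj : j.len < k),
          i ≫ b j τ hj = a ≫ X.map τ.op) →
        ∃ l : B ⟶ X _⦋k⦌, i ≫ l = a ∧
          ∀ (j : SimplexCategory) (τ : j ⟶ ⦋k⦌) (hj : j.len < k), l ≫ X.map τ.op = b j τ hj := by
  constructor
  · intro _ a b hb hab
    obtain ⟨u, hu⟩ := exists_matchingObj_lift b hb
    have sq : CommSq a i (matchingMap X k) u := ⟨by
      apply matchingObj_hom_ext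
      intro j τ hj
      rw [Category.assoc, Category.assoc, matchingMap_matchingπ, hu, hab]⟩
    refine ⟨sq.lift, sq.fac_left, fun j τ hj => ?_⟩
    rw [← hu, ← matchingMap_matchingπ X τ hj, ← Category.assoc, sq.fac_right]
  · intro h
    refine ⟨fun {a u} sq => ?_⟩
    obtain ⟨l, h₁, h₂⟩ := h a (fun j τ hj => u ≫ matchingπ X τ hj)
      (fun τ ρ hj hi => by rw [Category.assoc, matchingπ_map X τ ρ hj hi])
      (fun j τ hj => by
        have := sq.w =≫ matchingπ X τ hj
        rw [Category.assoc, Category.assoc, matchingMap_matchingπ] at this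
        exact this.symm)
    refine ⟨⟨{ l := l, fac_left := h₁, fac_right := matchingObj_hom_ext fun j τ hj => ?_ }⟩⟩
    rw [Category.assoc, matchingMap_matchingπ, h₂]

lemma isTerminal_obj (n : SimplexCategoryᵒᵖ) :
    Nonempty (IsTerminal ((⊤_ (SimplicialObject C)).obj n)) :=
  ⟨IsTerminal.isTerminalObj ((evaluation SimplexCategoryᵒᵖ C).obj n) _ terminalIsTerminal⟩

lemma isTerminal_matchingObj (k : ℕ) :
    Nonempty (IsTerminal (matchingObj (⊤_ (SimplicialObject C)) k)) := by
  have h (E : C) : ∃ u : E ⟶ matchingObj (⊤_ (SimplicialObject C)) k, True := by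
    obtain ⟨u, -⟩ := exists_matchingObj_lift (E := E) (k := k) (X := ⊤_ (SimplicialObject C))
      (fun j _ _ => (isTerminal_obj (op j)).some.from E)
      (fun _ _ _ _ => (isTerminal_obj _).some.hom_ext _ _)
    exact ⟨u, trivial⟩
  exact ⟨IsTerminal.ofUniqueHom (fun E => (h E).choose) fun E m =>
    matchingObj_hom_ext fun j τ hj => (isTerminal_obj _).some.hom_ext _ _⟩

/-- A simplicial object is Reedy fibrant if its matching maps are fibrations. -/
lemma isReedyFibration_terminal_from_iff [ModelCategory C] (X : SimplicialObject C) :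
    IsReedyFibration (terminal.from X) ↔ ∀ k, Fibration (matchingMap X k) := by
  refine forall_congr' fun k => ?_
  have h : relativeMatchingMap (terminal.from X) k ≫ pullback.snd _ _ = matchingMap X k :=
    pullback.lift_snd _ _ _
  have : IsIso (matchingMap (⊤_ (SimplicialObject C)) k) :=
    ⟨(isTerminal_obj (op ⦋k⦌)).some.from _, (isTerminal_obj (op ⦋k⦌)).some.hom_ext _ _,
      (isTerminal_matchingObj k).some.hom_ext _ _⟩
  rw [← h, fibration_iff]
  exact ((fibrations C).cancel_right_of_respectsIso _ _).symm

end Matching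

/-! ### Prolongations and Reedy structures -/

section Prolong

variable {C : Type u₁} [Category.{v} C] {D : Type u₂} [Category.{v} D]
  {L : C ⥤ D} {R : D ⥤ C} (adj : L ⊣ R)

include adj in
/-- Lifting problems against matching maps of `R Z` are transposed to lifting problems against
matching maps of `Z`. -/
lemma hasLiftingProperty_matchingMap_prolong [HasLimits C] [HasLimits D] {A B : C} (i : A ⟶ B)
    (Z : SimplicialObject D) (k : ℕ) [h : HasLiftingProperty (L.map i) (matchingMap Z k)] :
    HasLiftingProperty i (matchingMap ((prolong R).obj Z) k) := by
  rw [hasLiftingProperty_matchingMap_iff] at h ⊢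
  have key (a : A ⟶ R.obj (Z _⦋k⦌))
      (b : ∀ (j : SimplexCategory), (j ⟶ ⦋k⦌) → j.len < k → (B ⟶ R.obj (Z.obj (op j))))
      (hb : ∀ {i j : SimplexCategory} (τ : j ⟶ ⦋k⦌) (ρ : i ⟶ j) (hj : j.len < k) (hi : i.len < k),
        b j τ hj ≫ R.map (Z.map ρ.op) = b i (ρ ≫ τ) hi)
      (hab : ∀ (j : SimplexCategory) (τ : j ⟶ ⦋k⦌) (hj : j.len < k),
        i ≫ b j τ hj = a ≫ R.map (Z.map τ.op)) :
      ∃ l : B ⟶ R.obj (Z _⦋k⦌), i ≫ l = a ∧ ∀ (j : SimplexCategory) (τ : j ⟶ ⦋k⦌) (hj : j.len < k),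
        l ≫ R.map (Z.map τ.op) = b j τ hj := by
    obtain ⟨l, h₁, h₂⟩ := h ((adj.homEquiv _ _).symm a)
      (fun j τ hj => (adj.homEquiv _ _).symm (b j τ hj))
      (fun τ ρ hj hi => by rw [← hb τ ρ hj hi, adj.homEquiv_naturality_right_symm])
      (fun j τ hj => by
        rw [← adj.homEquiv_naturality_left_symm, hab, adj.homEquiv_naturality_right_symm])
    refine ⟨adj.homEquiv _ _ l, ?_, fun j τ hj => ?_⟩
    · rw [← adj.homEquiv_naturality_left, h₁, Equiv.apply_symm_apply]
    · rw [← adj.homEquiv_naturality_right, h₂ j τ hj, Equiv.apply_symm_apply]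
  exact key

include adj in
/-- Lifting problems for relative latching maps of `L f` are transposed to lifting problems for
relative latching maps of `f`. The latching colimits are never compared: everything is expressed
by families of morphisms indexed by operators. -/
lemma hasLiftingProperty_relativeLatchingMap_prolong [HasColimits C] [HasColimits D]
    {X Y : SimplicialObject C} (f : X ⟶ Y) {E F : D} (p : E ⟶ F) (k : ℕ)
    [HasLiftingProperty (relativeLatchingMap f k) (R.map p)] :
    HasLiftingProperty (relativeLatchingMap ((prolong L).map f) k) p := by
  have hinl {X' Y' : SimplicialObject D} (f' : X' ⟶ Y') :
      pushout.inl _ _ ≫ relativeLatchingMap f' k = f'.app (op ⦋k⦌) := pushout.inl_desc _ _ _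
  have hinr {X' Y' : SimplicialObject D} (f' : X' ⟶ Y') :
      pushout.inr _ _ ≫ relativeLatchingMap f' k = latchingMap Y' k := pushout.inr_desc _ _ _
  have hinl' : pushout.inl _ _ ≫ relativeLatchingMap f k = f.app (op ⦋k⦌) :=
    pushout.inl_desc _ _ _
  have hinr' : pushout.inr _ _ ≫ relativeLatchingMap f k = latchingMap Y k :=
    pushout.inr_desc _ _ _
  refine ⟨fun {u w} sq => ?_⟩
  let w' : L.obj (Y _⦋k⦌) ⟶ F := w
  let u₁ : L.obj (X _⦋k⦌) ⟶ E := pushout.inl _ _ ≫ u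
  let u₂ (j : SimplexCategory) (τ : ⦋k⦌ ⟶ j) (hj : j.len < k) : L.obj (Y.obj (op j)) ⟶ E :=
    latchingι ((prolong L).obj Y) τ hj ≫ pushout.inr _ _ ≫ u
  have hu₁ : u₁ ≫ p = L.map (f.app (op ⦋k⦌)) ≫ w' :=
    (Category.assoc _ _ _).trans ((congrArg (pushout.inl _ _ ≫ ·) sq.w).trans
      ((Category.assoc _ _ _).symm.trans (congrArg (· ≫ w) (hinl ((prolong L).map f)))))
  have hu₂ (j : SimplexCategory) (τ : ⦋k⦌ ⟶ j) (hj : j.len < k) :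
      u₂ j τ hj ≫ p = L.map (Y.map τ.op) ≫ w' := by
    have := latchingι_latchingMap ((prolong L).obj Y) τ hj =≫ w
    rw [← hinr ((prolong L).map f), Category.assoc, Category.assoc, ← sq.w] at this
    exact (Category.assoc _ _ _).trans ((congrArg (_ ≫ ·) (Category.assoc _ _ _)).trans this)
  have hu₂' {i j : SimplexCategory} (σ : ⦋k⦌ ⟶ j) (τ : j ⟶ i) (hj : j.len < k) (hi : i.len < k) :
      L.map (Y.map τ.op) ≫ u₂ j σ hj = u₂ i (σ ≫ τ) hi :=
    (Category.assoc _ _ _).symm.trans (congrArg (· ≫ pushout.inr _ _ ≫ u)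
      (map_latchingι ((prolong L).obj Y) σ τ hj hi))
  have hu₁₂ (j : SimplexCategory) (τ : ⦋k⦌ ⟶ j) (hj : j.len < k) :
      L.map (X.map τ.op) ≫ u₁ = L.map (f.app (op j)) ≫ u₂ j τ hj := by
    have h₁ := latchingι_latchingMap ((prolong L).obj X) τ hj =≫ pushout.inl _ _ ≫ u
    have h₂ := latchingι_latchingObjMap ((prolong L).map f) τ hj =≫ pushout.inr _ _ ≫ u
    rw [Category.assoc, pushout.condition_assoc, ← Category.assoc, h₂] at h₁
    exact h₁.symm.trans (Category.assoc _ _ _)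
  obtain ⟨d, hd⟩ := exists_latchingObj_desc (X := Y)
    (fun j τ hj => adj.homEquiv _ _ (u₂ j τ hj))
    (fun σ τ hj hi => by rw [← adj.homEquiv_naturality_left, hu₂' σ τ hj hi])
  have hw : latchingMap X k ≫ adj.homEquiv _ _ u₁ = latchingObjMap f k ≫ d := by
    apply latchingObj_hom_ext
    intro j τ hj
    rw [reassoc_of% (latchingι_latchingMap X τ hj), reassoc_of% (latchingι_latchingObjMap f τ hj),
      hd, ← adj.homEquiv_naturality_left, hu₁₂ j τ hj, adj.homEquiv_naturality_left]
  have sq' : CommSq (pushout.desc _ _ hw) (relativeLatchingMap f k) (R.map p)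
      (adj.homEquiv _ _ w') := ⟨by
    apply pushout.hom_ext
    · rw [pushout.inl_desc_assoc, reassoc_of% hinl', ← adj.homEquiv_naturality_right, hu₁,
        adj.homEquiv_naturality_left]
    · rw [pushout.inr_desc_assoc, reassoc_of% hinr']
      apply latchingObj_hom_ext
      intro j τ hj
      rw [reassoc_of% (hd j τ hj), reassoc_of% (latchingι_latchingMap Y τ hj),
        ← adj.homEquiv_naturality_right, hu₂, adj.homEquiv_naturality_left]⟩
  let l : L.obj (Y _⦋k⦌) ⟶ E := (adj.homEquiv _ _).symm sq'.lift
  have hl₁ : L.map (f.app (op ⦋k⦌)) ≫ l = u₁ := by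
    rw [← adj.homEquiv_naturality_left_symm, ← hinl', Category.assoc, sq'.fac_left,
      pushout.inl_desc, Equiv.symm_apply_apply]
  have hl₂ (j : SimplexCategory) (τ : ⦋k⦌ ⟶ j) (hj : j.len < k) :
      L.map (Y.map τ.op) ≫ l = u₂ j τ hj := by
    rw [← adj.homEquiv_naturality_left_symm, ← latchingι_latchingMap Y τ hj, ← hinr',
      Category.assoc, Category.assoc, sq'.fac_left, pushout.inr_desc, hd, Equiv.symm_apply_apply]
  let l' : ((prolong L).obj Y) _⦋k⦌ ⟶ E := l
  refine ⟨⟨{ l := l', fac_left := ?_, fac_right := ?_ }⟩⟩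
  · apply pushout.hom_ext
    · rw [reassoc_of% (hinl ((prolong L).map f))]
      exact hl₁
    · rw [reassoc_of% (hinr ((prolong L).map f))]
      apply latchingObj_hom_ext
      intro j τ hj
      rw [reassoc_of% (latchingι_latchingMap ((prolong L).obj Y) τ hj)]
      exact hl₂ j τ hj
  · have : l ≫ p = w' := by
      rw [← adj.homEquiv_naturality_right_symm, sq'.fac_right, Equiv.symm_apply_apply]
    exact this

variable [ModelCategory C] [ModelCategory D]

variable {adj} in
lemma IsQuillenAdjunction.isReedyCofibration_map [HasColimits C] [HasColimits D]
    (h : IsQuillenAdjunction adj) {X Y : SimplicialObject C} {f : X ⟶ Y}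
    (hf : IsReedyCofibration f) : IsReedyCofibration ((prolong L).map f) := by
  intro k
  rw [← trivialFibrations_llp]
  intro E F p hp
  obtain ⟨_, _⟩ := (mem_trivialFibrations_iff p).1 hp
  have := h.fibration_map p
  have := h.weakEquivalence_map_of_fibration p
  have : Cofibration (relativeLatchingMap f k) := ⟨hf k⟩
  exact hasLiftingProperty_relativeLatchingMap_prolong adj f p k

variable {adj} in
lemma IsQuillenAdjunction.isReedyFibrant_obj [HasLimits C] [HasLimits D]
    (h : IsQuillenAdjunction adj) {Z : SimplicialObject D}
    (hZ : IsReedyFibration (terminal.from Z)) :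
    IsReedyFibration (terminal.from ((prolong R).obj Z)) := by
  rw [isReedyFibration_terminal_from_iff] at hZ ⊢
  intro k
  constructor
  rw [← trivialCofibrations_rlp]
  intro A B i hi
  obtain ⟨_, _⟩ := (mem_trivialCofibrations_iff i).1 hi
  have := h.cofibration_map i
  have := h.weakEquivalence_map i
  have := hZ k
  exact hasLiftingProperty_matchingMap_prolong adj i Z k

variable {adj} in
/-- The prolongation of a right Quillen functor preserves fibrant objects of the canonical model
structures. -/
lemma IsQuillenAdjunction.isFibrant_prolong_obj [HasLimits C] [HasLimits D] [HasColimits C]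
    [HasColimits D] [ModelCategory (SimplicialObject C)] [ModelCategory (SimplicialObject D)]
    (h : IsQuillenAdjunction adj) (hC : IsCanonicalModelStructure C)
    (hD : IsCanonicalModelStructure D) (hD' : IsSimplicialModelStructure D)
    (Z : SimplicialObject D) [IsFibrant Z] : IsFibrant ((prolong R).obj Z) := by
  have hZ (n : SimplexCategory) : IsFibrant (Z.obj (op n)) := hD.isFibrant_obj hD' Z n
  obtain ⟨⟨h₁, h₂⟩, h₃⟩ := (hD.isFibrant_iff Z).1 inferInstance
  rw [hC.isFibrant_iff]
  refine ⟨⟨fun n i => ?_, fun n i => ?_⟩, h.isReedyFibrant_obj h₃⟩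
  · have : WeakEquivalence (Z.δ i) := ⟨h₁ n i⟩
    have := hZ ⦋n + 1⦌
    have := hZ ⦋n⦌
    exact (h.weakEquivalence_map_of_isFibrant (Z.δ i)).mem
  · have : WeakEquivalence (Z.σ i) := ⟨h₂ n i⟩
    have := hZ ⦋n + 1⦌
    have := hZ ⦋n⦌
    exact (h.weakEquivalence_map_of_isFibrant (Z.σ i)).mem

end Prolong

/-! ### The vertices of the interval -/

section Interval

/-- The constant simplex of `Δ[1]` at a vertex. -/
def intervalVertex (b : Fin 2) (n : SimplexCategoryᵒᵖ) : (SSet.stdSimplex.{v}.obj ⦋1⦌).obj n :=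
  SSet.stdSimplex.objEquiv.symm (SimplexCategory.const n.unop ⦋1⦌ b)

lemma intervalVertex_injective (n : SimplexCategoryᵒᵖ) :
    Function.Injective fun b => intervalVertex.{v} b n := by
  intro b b' h
  have := SSet.stdSimplex.objEquiv.symm.injective h
  exact congrArg (fun g => SimplexCategory.Hom.toOrderHom g 0) this

/-- The inclusion of a vertex of the interval. -/
def intervalPt (b : Fin 2) : SSet.stdSimplex.{v}.obj ⦋0⦌ ⟶ SSet.stdSimplex.obj ⦋1⦌ where
  app n := ↾fun _ => intervalVertex b n
  naturality _ _ _ := rfl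

instance (n : SimplexCategoryᵒᵖ) : Unique ((SSet.stdSimplex.{v}.obj ⦋0⦌).obj n) where
  default := SSet.stdSimplex.objEquiv.symm (SimplexCategory.const n.unop ⦋0⦌ 0)
  uniq a := SSet.stdSimplex.objEquiv.injective (by
    ext : 3
    exact Subsingleton.elim (α := Fin 1) _ _)

instance (b : Fin 2) : Mono (intervalPt.{v} b) := by
  have (n : SimplexCategoryᵒᵖ) : Mono ((intervalPt.{v} b).app n) := by
    rw [CategoryTheory.mono_iff_injective]
    exact fun _ _ _ => Subsingleton.elim _ _
  exact NatTrans.mono_of_mono_app _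

/-- The pair of vertices of the interval, as a discrete simplicial set. -/
def intervalEnds : SSet.{v} := (Functor.const _).obj (ULift (Fin 2))

/-- The inclusion of the pair of vertices of the interval. -/
def intervalEndsι : intervalEnds.{v} ⟶ SSet.stdSimplex.obj ⦋1⦌ where
  app n := ↾fun b => intervalVertex b.down n
  naturality _ _ _ := rfl

instance : Mono intervalEndsι.{v} := by
  have (n : SimplexCategoryᵒᵖ) : Mono (intervalEndsι.{v}.app n) := by
    rw [CategoryTheory.mono_iff_injective]
    exact fun _ _ h => ULift.ext _ _ (intervalVertex_injective n h)
  exact NatTrans.mono_of_mono_app _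

instance (n : SimplexCategory) :
    ContractibleSpace (SSet.toTop.{v}.obj (SSet.stdSimplex.obj n)) := by
  have : ContractibleSpace (SimplexCategory.toTop₀.obj n) :=
    (convex_stdSimplex ℝ (Fin (n.len + 1))).contractibleSpace
      ⟨_, (Classical.arbitrary (stdSimplex ℝ (Fin (n.len + 1)))).2⟩
  exact ((TopCat.homeoOfIso (SSet.toTopSimplex.{v}.app n)).trans
    Homeomorph.ulift).contractibleSpace

lemma isSSetWeakEquivalence_of_contractible {K L : SSet.{v}}
    [ContractibleSpace (SSet.toTop.obj K)] [ContractibleSpace (SSet.toTop.obj L)] (i : K ⟶ L) :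
    IsSSetWeakEquivalence i := by
  have h {X : TopCat.{v}} [ContractibleSpace X] (g : C(X, X)) :
      g.Homotopic (ContinuousMap.id X) := by
    obtain ⟨x, hx⟩ := id_nullhomotopic X
    have h₁ := hx.comp (ContinuousMap.Homotopic.refl g)
    have h₂ : (ContinuousMap.const X x).Homotopic (ContinuousMap.id X) := hx.symm
    exact h₁.trans h₂
  let x : SSet.toTop.obj K := Classical.arbitrary _
  exact ⟨⟨(SSet.toTop.map i).hom, ContinuousMap.const _ x, h _, h _⟩, rfl⟩

end Interval

/-! ### Morphisms out of tensors -/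

section TensorHom

variable {C : Type u} [Category.{v} C] [HasColimits C]

/-- The inclusion of `X_n` as the summand of `(X ⊗ K)_n` indexed by a simplex. -/
def tensorι (X : SimplicialObject C) {K : SSet.{v}} {n : SimplexCategoryᵒᵖ} (k : K.obj n) :
    X.obj n ⟶ (tensorObj X K).obj n :=
  Sigma.ι (fun _ : K.obj n => X.obj n) k

lemma tensorι_map (X : SimplicialObject C) {K : SSet.{v}} {m n : SimplexCategoryᵒᵖ} (g : m ⟶ n)
    (k : K.obj m) : tensorι X k ≫ (tensorObj X K).map g = X.map g ≫ tensorι X (K.map g k) :=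
  Sigma.ι_desc _ _

lemma tensorι_tensorMap {X Y : SimplicialObject C} (f : X ⟶ Y) {K L : SSet.{v}} (i : K ⟶ L)
    {n : SimplexCategoryᵒᵖ} (k : K.obj n) :
    tensorι X k ≫ (tensorMap f i).app n = f.app n ≫ tensorι Y (i.app n k) :=
  Sigma.ι_desc _ _

lemma tensorι_tensorMap_comp {X Y Z : SimplicialObject C} (f : X ⟶ Y) {K L : SSet.{v}}
    (i : K ⟶ L) (φ : tensorObj Y L ⟶ Z) {n : SimplexCategoryᵒᵖ} (k : K.obj n) :
    tensorι X k ≫ (tensorMap f i ≫ φ).app n = f.app n ≫ tensorι Y (i.app n k) ≫ φ.app n := by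
  rw [NatTrans.comp_app, reassoc_of% (tensorι_tensorMap f i k)]

lemma tensor_hom_ext {X Y : SimplicialObject C} {K : SSet.{v}} {φ ψ : tensorObj X K ⟶ Y}
    (h : ∀ (n : SimplexCategoryᵒᵖ) (k : K.obj n), tensorι X k ≫ φ.app n = tensorι X k ≫ ψ.app n) :
    φ = ψ :=
  NatTrans.ext (funext fun n => Sigma.hom_ext _ _ (h n))

/-- The morphism `X ⊗ K ⟶ Y` given by a compatible family of morphisms `X_n ⟶ Y_n` indexed by
the simplices of `K`. -/
def tensorDesc {X Y : SimplicialObject C} {K : SSet.{v}}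
    (φ : ∀ {n : SimplexCategoryᵒᵖ}, K.obj n → (X.obj n ⟶ Y.obj n))
    (w : ∀ {m n : SimplexCategoryᵒᵖ} (g : m ⟶ n) (k : K.obj m),
      X.map g ≫ φ (K.map g k) = φ k ≫ Y.map g) : tensorObj X K ⟶ Y where
  app n := Sigma.desc fun k => φ k
  naturality m n g := by
    apply Sigma.hom_ext
    intro k
    dsimp only [tensorObj]
    rw [Sigma.ι_desc_assoc, Sigma.ι_desc_assoc, Category.assoc, Sigma.ι_desc, w]

/-- The compatibility of the components of a morphism out of a tensor with the operators. -/
lemma tensorι_comp_app_map {X Y : SimplicialObject C} {K : SSet.{v}} (φ : tensorObj X K ⟶ Y)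
    {m n : SimplexCategoryᵒᵖ} (g : m ⟶ n) (k : K.obj m) :
    X.map g ≫ tensorι X (K.map g k) ≫ φ.app n = (tensorι X k ≫ φ.app m) ≫ Y.map g := by
  rw [← Category.assoc, ← tensorι_map, Category.assoc, φ.naturality, Category.assoc]

/-- The projection `X ⊗ K ⟶ X`. -/
def tensorProj (X : SimplicialObject C) (K : SSet.{v}) : tensorObj X K ⟶ X :=
  tensorDesc (fun {n} _ => 𝟙 (X.obj n)) (fun _ _ => by rw [Category.comp_id, Category.id_comp])

lemma tensorι_tensorProj (X : SimplicialObject C) {K : SSet.{v}} {n : SimplexCategoryᵒᵖ}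
    (k : K.obj n) : tensorι X k ≫ (tensorProj X K).app n = 𝟙 _ :=
  Sigma.ι_desc _ _

lemma tensorMap_tensorProj {X Y : SimplicialObject C} (f : X ⟶ Y) {K L : SSet.{v}} (i : K ⟶ L) :
    tensorMap f i ≫ tensorProj Y L = tensorProj X K ≫ f := by
  apply tensor_hom_ext
  intro n k
  rw [NatTrans.comp_app, NatTrans.comp_app, reassoc_of% (tensorι_tensorMap f i k),
    tensorι_tensorProj, reassoc_of% (tensorι_tensorProj X k), Category.comp_id]

/-- The section `X ⟶ X ⊗ K` of the projection at a point of `K`. -/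
def tensorSection (X : SimplicialObject C) {K : SSet.{v}} (p : SSet.stdSimplex.obj ⦋0⦌ ⟶ K) :
    X ⟶ tensorObj X K where
  app n := tensorι X (p.app n default)
  naturality m n g := by
    rw [tensorι_map]
    congr 2
    exact (congrArg (p.app n) (Subsingleton.elim _ _)).trans
      (ConcreteCategory.congr_hom (p.naturality g) default)

lemma tensorSection_tensorProj (X : SimplicialObject C) {K : SSet.{v}}
    (p : SSet.stdSimplex.obj ⦋0⦌ ⟶ K) : tensorSection X p ≫ tensorProj X K = 𝟙 X :=
  NatTrans.ext (funext fun _ => tensorι_tensorProj _ _)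

lemma tensorProj_tensorSection (X : SimplicialObject C) {K : SSet.{v}}
    (p : SSet.stdSimplex.obj ⦋0⦌ ⟶ K) :
    tensorProj X (SSet.stdSimplex.obj ⦋0⦌) ≫ tensorSection X p = tensorMap (𝟙 X) p := by
  apply tensor_hom_ext
  intro n k
  rw [NatTrans.comp_app, reassoc_of% (tensorι_tensorProj X k), tensorι_tensorMap,
    Subsingleton.elim k default]
  exact (Category.id_comp _).symm

lemma comp_tensorSection {X Y : SimplicialObject C} (f : X ⟶ Y) {K : SSet.{v}}
    (p : SSet.stdSimplex.obj ⦋0⦌ ⟶ K) :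
    f ≫ tensorSection Y p = tensorSection X p ≫ tensorMap f (𝟙 K) :=
  NatTrans.ext (funext fun n => (tensorι_tensorMap f (𝟙 K) (p.app n default)).symm)

/-- A pair of morphisms `X ⟶ Y` is a morphism from the tensor with the ends of the interval. -/
def tensorEndsDesc {X Y : SimplicialObject C} (f : Fin 2 → (X ⟶ Y)) :
    tensorObj X intervalEnds.{v} ⟶ Y :=
  tensorDesc (fun {n} k => (f k.down).app n) (fun g k => (f k.down).naturality g)

lemma tensorι_tensorEndsDesc {X Y : SimplicialObject C} (f : Fin 2 → (X ⟶ Y))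
    {n : SimplexCategoryᵒᵖ} (k : intervalEnds.{v}.obj n) :
    tensorι X k ≫ (tensorEndsDesc f).app n = (f k.down).app n :=
  Sigma.ι_desc _ _

end TensorHom

/-! ### Detecting trivial cofibrations by extensions -/

section Extension

variable {C : Type u} [Category.{v} C] [HasColimits C] [ModelCategory (SimplicialObject C)]

namespace IsSimplicialModelStructure

variable (h : IsSimplicialModelStructure C)
include h

lemma weakEquivalence_pushoutProduct_intervalPt {A B : SimplicialObject C} (i : A ⟶ B)
    [Cofibration i] (b : Fin 2) : Cofibration (pushoutProduct i (intervalPt.{v} b)) ∧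
      WeakEquivalence (pushoutProduct i (intervalPt.{v} b)) :=
  ⟨⟨h.cofibration i _ (mem_cofibrations i) inferInstance⟩,
    ⟨h.weakEquivalence_right i _ (mem_cofibrations i) inferInstance
      (isSSetWeakEquivalence_of_contractible _)⟩⟩

/-- Morphisms which are homotopic relative to a cofibration `i : A ⟶ B` agree in the homotopy
category. The homotopy factors through the relative cylinder `Cyl`, the pushout of `B ⊗ Δ[1]` along
the map to `B` from the union of `A ⊗ Δ[1]` and `B ⊗ {0}`; by SM7 the end `s₀ : B ⟶ Cyl` is a
weak equivalence, so the projection `Cyl ⟶ B` identifies both ends. -/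
lemma map_eq_of_homotopy {H : Type*} [Category* H] (Q : SimplicialObject C ⥤ H)
    [Q.IsLocalization (weakEquivalences (SimplicialObject C))]
    {A B Z : SimplicialObject C} (i : A ⟶ B) [Cofibration i] (a : A ⟶ Z)
    (φ : tensorObj B (SSet.stdSimplex.{v}.obj ⦋1⦌) ⟶ Z)
    (hφ : tensorMap i (𝟙 _) ≫ φ = tensorProj A _ ≫ a) :
    Q.map (tensorSection B (intervalPt 0) ≫ φ) = Q.map (tensorSection B (intervalPt 1) ≫ φ) := by
  obtain ⟨_, _⟩ := h.weakEquivalence_pushoutProduct_intervalPt i 0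
  let g : pushout (tensorMap (𝟙 A) (intervalPt.{v} 0)) (tensorMap i (𝟙 _)) ⟶ B :=
    pushout.desc (tensorProj A _ ≫ i) (tensorProj B _) (by
      rw [tensorMap_tensorProj, ← Category.assoc, tensorMap_tensorProj, Category.comp_id])
  let s₀ : B ⟶ pushout g (pushoutProduct i (intervalPt.{v} 0)) := pushout.inl _ _
  let t : tensorObj B (SSet.stdSimplex.{v}.obj ⦋1⦌) ⟶
    pushout g (pushoutProduct i (intervalPt.{v} 0)) := pushout.inr _ _
  have desc {Z : SimplicialObject C} (a : A ⟶ Z)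
      (φ : tensorObj B (SSet.stdSimplex.{v}.obj ⦋1⦌) ⟶ Z)
      (hφ : tensorMap i (𝟙 _) ≫ φ = tensorProj A _ ≫ a) :
      ∃ ψ : pushout g (pushoutProduct i (intervalPt.{v} 0)) ⟶ Z,
        s₀ ≫ ψ = tensorSection B (intervalPt 0) ≫ φ ∧ t ≫ ψ = φ := by
    refine ⟨pushout.desc (tensorSection B (intervalPt 0) ≫ φ) φ ?_, pushout.inl_desc _ _ _,
      pushout.inr_desc _ _ _⟩
    apply pushout.hom_ext
    · have e : i ≫ tensorSection B (intervalPt 0) ≫ φ = a := by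
        rw [reassoc_of% (comp_tensorSection i (intervalPt.{v} 0)), hφ,
          reassoc_of% (tensorSection_tensorProj A (intervalPt.{v} 0))]
      rw [pushout.inl_desc_assoc, Category.assoc, e, ← hφ, ← Category.assoc]
      exact congrArg (· ≫ φ) (pushout.inl_desc _ _ _).symm
    · rw [pushout.inr_desc_assoc, reassoc_of% (tensorProj_tensorSection B (intervalPt.{v} 0)),
        ← Category.assoc]
      exact congrArg (· ≫ φ) (pushout.inr_desc _ _ _).symm
  obtain ⟨ψ, hψ₀, hψ⟩ := desc a φ hφ
  obtain ⟨π, hπ₀, hπ⟩ := desc i (tensorProj B _) (tensorMap_tensorProj _ _)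
  rw [tensorSection_tensorProj] at hπ₀
  have hπ₁ : (tensorSection B (intervalPt 1) ≫ t) ≫ π = 𝟙 B := by
    rw [Category.assoc, hπ, tensorSection_tensorProj]
  have : WeakEquivalence s₀ := inferInstanceAs (WeakEquivalence (pushout.inl _ _))
  have : WeakEquivalence π := weakEquivalence_of_precomp_of_fac hπ₀
  have := isIso_map_of_weakEquivalence Q π
  have e : Q.map s₀ = Q.map (tensorSection B (intervalPt 1) ≫ t) := by
    rw [← cancel_mono (Q.map π), ← Q.map_comp, ← Q.map_comp, hπ₀, hπ₁]
  rw [← hψ₀, Q.map_comp, e, ← Q.map_comp, Category.assoc, hψ]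

/-- A cofibration `i : A ⟶ B` is a weak equivalence if, for every fibrant `Z`, maps to `Z` extend
along `i`, uniquely up to homotopy relative to `A`. -/
lemma weakEquivalence_of_extension {A B : SimplicialObject C} (i : A ⟶ B) [Cofibration i]
    (h₁ : ∀ (Z : SimplicialObject C) [IsFibrant Z] (a : A ⟶ Z), ∃ b : B ⟶ Z, i ≫ b = a)
    (h₂ : ∀ (Z : SimplicialObject C) [IsFibrant Z]
      (a : tensorObj A (SSet.stdSimplex.{v}.obj ⦋1⦌) ⟶ Z) (b : tensorObj B intervalEnds.{v} ⟶ Z),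
      tensorMap (𝟙 A) intervalEndsι ≫ a = tensorMap i (𝟙 _) ≫ b →
      ∃ c : tensorObj B (SSet.stdSimplex.{v}.obj ⦋1⦌) ⟶ Z,
        tensorMap i (𝟙 _) ≫ c = a ∧ tensorMap (𝟙 B) intervalEndsι ≫ c = b) :
    WeakEquivalence i := by
  let Q := (weakEquivalences (SimplicialObject C)).Q
  let r (X : SimplicialObject C) := FibrantObject.HoCat.iResolutionObj X
  have hr (X : SimplicialObject C) : IsIso (Q.map (r X)) := isIso_map_of_weakEquivalence Q _
  obtain ⟨f, hf⟩ := h₁ _ (r A)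
  have sq : CommSq (i ≫ r B) (r A) (terminal.from _) (terminal.from _) := ⟨terminal.hom_ext _ _⟩
  obtain ⟨q, hq⟩ : ∃ q, r A ≫ q = i ≫ r B := ⟨sq.lift, sq.fac_left⟩
  obtain ⟨c, hc₁, hc₂⟩ := h₂ _ (tensorProj A _ ≫ i ≫ r B) (tensorEndsDesc ![f ≫ q, r B]) (by
    apply tensor_hom_ext
    intro n k
    rw [tensorι_tensorMap_comp, tensorι_tensorMap_comp, tensorι_tensorEndsDesc, NatTrans.comp_app,
      reassoc_of% (tensorι_tensorProj A (intervalEndsι.{v}.app n k))]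
    refine (Category.id_comp _).trans ?_
    have hk (b : Fin 2) : i ≫ (![f ≫ q, r B] : Fin 2 → _) b = i ≫ r B := by
      fin_cases b
      · exact (Category.assoc _ _ _).symm.trans ((congrArg (· ≫ q) hf).trans hq)
      · rfl
    exact (NatTrans.congr_app (hk k.down) n).symm)
  have hend (b : Fin 2) : tensorSection B (intervalPt b) ≫ c = ![f ≫ q, r B] b := by
    ext n : 2
    let k : intervalEnds.{v}.obj n := ULift.up b
    have := tensorι B k ≫= NatTrans.congr_app hc₂ n
    rw [tensorι_tensorMap_comp] at this
    exact (Category.id_comp _).symm.trans (this.trans (tensorι_tensorEndsDesc _ k))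
  have e : Q.map f ≫ Q.map q = Q.map (r B) := by
    have := h.map_eq_of_homotopy Q i _ c hc₁
    rw [hend, hend] at this
    exact (Q.map_comp _ _).symm.trans this
  have e' : Q.map i ≫ Q.map f = Q.map (r A) := by rw [← Q.map_comp, hf]
  -- `Q.map f` has a left and a right inverse, hence is an isomorphism, and so is `Q.map i`.
  have : IsSplitMono (Q.map f) := ⟨⟨⟨Q.map q ≫ inv (Q.map (r B)), by
    rw [← Category.assoc, e, IsIso.hom_inv_id]⟩⟩⟩
  have : IsSplitEpi (Q.map f) := ⟨⟨⟨inv (Q.map (r A)) ≫ Q.map i, by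
    rw [Category.assoc, e', IsIso.inv_hom_id]⟩⟩⟩
  have := isIso_of_mono_of_isSplitEpi (Q.map f)
  rw [← isIso_map_iff_weakEquivalence Q]
  have : IsIso (Q.map i ≫ Q.map f) := by rw [e']; infer_instance
  exact IsIso.of_isIso_comp_right (Q.map i) (Q.map f)

end IsSimplicialModelStructure

end Extension

/-! ### The prolongation of a Quillen adjunction -/

section Transpose

variable {C : Type u₁} [Category.{v} C] [HasColimits C] {D : Type u₂} [Category.{v} D]
  [HasColimits D] {L : C ⥤ D} {R : D ⥤ C} (adj : L ⊣ R)

/-- The transpose `X ⊗ K ⟶ R Z` of a morphism `L X ⊗ K ⟶ Z`. -/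
def tensorTranspose {X : SimplicialObject C} {K : SSet.{v}} {Z : SimplicialObject D}
    (φ : tensorObj ((prolong L).obj X) K ⟶ Z) : tensorObj X K ⟶ (prolong R).obj Z :=
  tensorDesc (fun {n} k => adj.homEquiv (X.obj n) (Z.obj n)
      (tensorι ((prolong L).obj X) k ≫ φ.app n))
    (fun g k => (adj.homEquiv_naturality_left _ _).symm.trans
      ((congrArg (adj.homEquiv _ _) (tensorι_comp_app_map φ g k)).trans
        (adj.homEquiv_naturality_right _ _)))

/-- The transpose `L X ⊗ K ⟶ Z` of a morphism `X ⊗ K ⟶ R Z`. -/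
def tensorUntranspose {X : SimplicialObject C} {K : SSet.{v}} {Z : SimplicialObject D}
    (φ : tensorObj X K ⟶ (prolong R).obj Z) : tensorObj ((prolong L).obj X) K ⟶ Z :=
  tensorDesc (fun {n} k => (adj.homEquiv (X.obj n) (Z.obj n)).symm (tensorι X k ≫ φ.app n))
    (fun g k => (adj.homEquiv_naturality_left_symm _ _).symm.trans
      ((congrArg (adj.homEquiv _ _).symm (tensorι_comp_app_map φ g k)).trans
        (adj.homEquiv_naturality_right_symm _ _)))

lemma tensorι_tensorTranspose {X : SimplicialObject C} {K : SSet.{v}} {Z : SimplicialObject D}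
    (φ : tensorObj ((prolong L).obj X) K ⟶ Z) {n : SimplexCategoryᵒᵖ} (k : K.obj n) :
    tensorι X k ≫ (tensorTranspose adj φ).app n =
      adj.homEquiv (X.obj n) (Z.obj n) (tensorι ((prolong L).obj X) k ≫ φ.app n) :=
  Sigma.ι_desc _ _

lemma tensorι_tensorUntranspose {X : SimplicialObject C} {K : SSet.{v}} {Z : SimplicialObject D}
    (φ : tensorObj X K ⟶ (prolong R).obj Z) {n : SimplexCategoryᵒᵖ} (k : K.obj n) :
    tensorι ((prolong L).obj X) k ≫ (tensorUntranspose adj φ).app n =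
      (adj.homEquiv (X.obj n) (Z.obj n)).symm (tensorι X k ≫ φ.app n) :=
  Sigma.ι_desc _ _

lemma tensorUntranspose_tensorTranspose {X : SimplicialObject C} {K : SSet.{v}}
    {Z : SimplicialObject D} (φ : tensorObj ((prolong L).obj X) K ⟶ Z) :
    tensorUntranspose adj (tensorTranspose adj φ) = φ := by
  apply tensor_hom_ext
  intro n k
  exact (tensorι_tensorUntranspose adj _ k).trans
    ((congrArg (adj.homEquiv _ _).symm (tensorι_tensorTranspose adj φ k)).trans
      (Equiv.symm_apply_apply _ _))

lemma tensorMap_tensorTranspose {X Y : SimplicialObject C} (f : X ⟶ Y) {K M : SSet.{v}}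
    (i : K ⟶ M) {Z : SimplicialObject D} (φ : tensorObj ((prolong L).obj Y) M ⟶ Z) :
    tensorMap f i ≫ tensorTranspose adj φ =
      tensorTranspose adj (tensorMap ((prolong L).map f) i ≫ φ) := by
  apply tensor_hom_ext
  intro n k
  refine (tensorι_tensorMap_comp f i _ k).trans (Eq.trans ?_ (tensorι_tensorTranspose adj _ k).symm)
  refine (congrArg (f.app n ≫ ·) (tensorι_tensorTranspose adj φ (i.app n k))).trans ?_
  exact (adj.homEquiv_naturality_left _ _).symm.trans
    (congrArg (adj.homEquiv _ _) (tensorι_tensorMap_comp ((prolong L).map f) i φ k).symm)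

lemma tensorMap_tensorUntranspose {X Y : SimplicialObject C} (f : X ⟶ Y) {K M : SSet.{v}}
    (i : K ⟶ M) {Z : SimplicialObject D} (φ : tensorObj Y M ⟶ (prolong R).obj Z) :
    tensorMap ((prolong L).map f) i ≫ tensorUntranspose adj φ =
      tensorUntranspose adj (tensorMap f i ≫ φ) := by
  apply tensor_hom_ext
  intro n k
  refine (tensorι_tensorMap_comp ((prolong L).map f) i _ k).trans
    (Eq.trans ?_ (tensorι_tensorUntranspose adj _ k).symm)
  refine (congrArg (L.map (f.app n) ≫ ·) (tensorι_tensorUntranspose adj φ (i.app n k))).trans ?_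
  exact (adj.homEquiv_naturality_left_symm _ _).symm.trans
    (congrArg (adj.homEquiv _ _).symm (tensorι_tensorMap_comp f i φ k).symm)

end Transpose

section Quillen

variable {C : Type u₁} [Category.{v} C] [HasLimits C] [HasColimits C] [ModelCategory C]
  [ModelCategory (SimplicialObject C)]
  {D : Type u₂} [Category.{v} D] [HasLimits D] [HasColimits D] [ModelCategory D]
  [ModelCategory (SimplicialObject D)] {L : C ⥤ D} {R : D ⥤ C} {adj : L ⊣ R}

/-- The prolongation of a Quillen adjunction is a Quillen adjunction: the image of a trivial
cofibration is a cofibration, and it is a weak equivalence by the extension criterion since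
the prolongation of the right adjoint preserves fibrant objects. -/
theorem IsQuillenAdjunction.isQuillenAdjunction_prolongAdj (h : IsQuillenAdjunction adj)
    (hC : IsCanonicalModelStructure C) (hC' : IsSimplicialModelStructure C)
    (hD : IsCanonicalModelStructure D) (hD' : IsSimplicialModelStructure D) :
    IsQuillenAdjunction (prolongAdj adj) := by
  have hcof {X Y : SimplicialObject C} (f : X ⟶ Y) (hf : cofibrations _ f) :
      cofibrations _ ((prolong L).map f) :=
    (hD.cofibration_iff _).2 (h.isReedyCofibration_map ((hC.cofibration_iff f).1 hf))
  refine ⟨hcof, fun {X Y} f hf => ?_⟩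
  obtain ⟨_, _⟩ := (mem_trivialCofibrations_iff f).1 hf
  have : Cofibration ((prolong L).map f) := ⟨hcof f (mem_cofibrations f)⟩
  refine (mem_trivialCofibrations_iff _).2 ⟨this, ?_⟩
  refine hD'.weakEquivalence_of_extension _ (fun Z _ a => ?_) (fun Z _ a b hab => ?_)
  · have := h.isFibrant_prolong_obj hC hD hD' Z
    have sq : CommSq ((prolongAdj adj).homEquiv _ _ a) f (terminal.from _) (terminal.from _) :=
      ⟨terminal.hom_ext _ _⟩
    refine ⟨((prolongAdj adj).homEquiv _ _).symm sq.lift, ?_⟩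
    rw [← Adjunction.homEquiv_naturality_left_symm, sq.fac_left, Equiv.symm_apply_apply]
  · have := h.isFibrant_prolong_obj hC hD hD' Z
    have : Cofibration (pushoutProduct f intervalEndsι.{v}) :=
      ⟨hC'.cofibration f _ (mem_cofibrations f) inferInstance⟩
    have : WeakEquivalence (pushoutProduct f intervalEndsι.{v}) :=
      ⟨hC'.weakEquivalence_left f _ (mem_cofibrations f) inferInstance (mem_weakEquivalences f)⟩
    have hab' : tensorMap (𝟙 X) intervalEndsι ≫ tensorTranspose adj a =
        tensorMap f (𝟙 _) ≫ tensorTranspose adj b := by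
      rw [tensorMap_tensorTranspose, tensorMap_tensorTranspose, ← hab, (prolong L).map_id]
    have sq : CommSq (pushout.desc _ _ hab') (pushoutProduct f intervalEndsι.{v})
      (terminal.from _) (terminal.from _) := ⟨terminal.hom_ext _ _⟩
    have e₁ : tensorMap f (𝟙 _) ≫ sq.lift = tensorTranspose adj a := by
      have := pushout.inl _ _ ≫= sq.fac_left
      rw [pushout.inl_desc, ← Category.assoc] at this
      exact (congrArg (· ≫ sq.lift) (pushout.inl_desc _ _ _)).symm.trans this
    have e₂ : tensorMap (𝟙 Y) intervalEndsι ≫ sq.lift = tensorTranspose adj b := by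
      have := pushout.inr _ _ ≫= sq.fac_left
      rw [pushout.inr_desc, ← Category.assoc] at this
      exact (congrArg (· ≫ sq.lift) (pushout.inr_desc _ _ _)).symm.trans this
    refine ⟨tensorUntranspose adj sq.lift, ?_, ?_⟩
    · rw [tensorMap_tensorUntranspose, e₁, tensorUntranspose_tensorTranspose]
    · rw [← (prolong L).map_id, tensorMap_tensorUntranspose, e₂, tensorUntranspose_tensorTranspose]

end Quillen

/-! ### Replacing a matching map with a fibration -/

section Attach

variable {C : Type u} [Category.{v} C]

/-- An operator to `[k]` factors through some `[l]` with `l < k`, that is, it is not surjective. -/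
def FactorsBelow {k : ℕ} {n : SimplexCategory} (σ : n ⟶ ⦋k⦌) : Prop :=
  ∃ (l : SimplexCategory) (a : n ⟶ l) (b : l ⟶ ⦋k⦌), a ≫ b = σ ∧ l.len < k

lemma FactorsBelow.comp {k : ℕ} {m n : SimplexCategory} {σ : n ⟶ ⦋k⦌} (h : FactorsBelow σ)
    (g : m ⟶ n) : FactorsBelow (g ≫ σ) := by
  obtain ⟨l, a, b, rfl, hl⟩ := h
  exact ⟨l, g ≫ a, b, Category.assoc _ _ _, hl⟩

lemma factorsBelow_of_lt {k : ℕ} {n : SimplexCategory} (σ : n ⟶ ⦋k⦌) (hn : n.len < k) :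
    FactorsBelow σ :=
  ⟨n, 𝟙 n, σ, Category.id_comp _, hn⟩

section Matching

variable [HasLimits C] {X : SimplicialObject C} {k : ℕ} {E : C} (w : E ⟶ matchingObj X k)

/-- The component at an operator `[n] ⟶ [k]` that factors through lower degrees of a morphism to
the matching object. -/
def matchingComponent {n : SimplexCategory} {σ : n ⟶ ⦋k⦌} (h : FactorsBelow σ) :
    E ⟶ X.obj (op n) :=
  w ≫ matchingπ X h.choose_spec.choose_spec.choose h.choose_spec.choose_spec.choose_spec.2 ≫
    X.map h.choose_spec.choose.op

/-- The component does not depend on the factorization through lower degrees. -/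
lemma matchingComponent_eq {n l : SimplexCategory} (a : n ⟶ l) (b : l ⟶ ⦋k⦌) (hl : l.len < k)
    (h : FactorsBelow (a ≫ b)) :
    matchingComponent w h = w ≫ matchingπ X b hl ≫ X.map a.op := by
  have key {l l' : SimplexCategory} {a : n ⟶ l} {b : l ⟶ ⦋k⦌} {a' : n ⟶ l'} {b' : l' ⟶ ⦋k⦌}
      (hab : a ≫ b = a' ≫ b') (hl : l.len < k) (hl' : l'.len < k) :
      matchingπ X b hl ≫ X.map a.op = matchingπ X b' hl' ≫ X.map a'.op := by
    obtain ⟨q, r, e, m, e', m', t, hq, hr, rfl, rfl, het, htm⟩ := exists_diagonal hab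
    have hq' := hq.trans_lt hl
    have hr' := hr.trans_lt hl'
    rw [op_comp, X.map_comp, ← Category.assoc, matchingπ_map X b m hl hq',
      ← matchingπ_map X m' e' hr' hl', Category.assoc, ← X.map_comp, ← op_comp, ← het, op_comp,
      X.map_comp, ← Category.assoc, matchingπ_map X m' t hr' hq']
    congr 2
    exact htm.symm
  exact congrArg (w ≫ ·) (key h.choose_spec.choose_spec.choose_spec.1 _ hl)

lemma matchingComponent_map {m n : SimplexCategory} {σ : n ⟶ ⦋k⦌} (h : FactorsBelow σ)
    (g : m ⟶ n) : matchingComponent w h ≫ X.map g.op = matchingComponent w (h.comp g) := by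
  obtain ⟨l, a, b, rfl, hl⟩ := id h
  have e : g ≫ a ≫ b = (g ≫ a) ≫ b := (Category.assoc _ _ _).symm
  have e' : matchingComponent w (h.comp g) = matchingComponent w (e ▸ h.comp g) := by
    congr 1
  rw [e', matchingComponent_eq w a b hl, matchingComponent_eq w (g ≫ a) b hl, op_comp, X.map_comp,
    Category.assoc, Category.assoc]

lemma matchingComponent_of_lt {n : SimplexCategory} (σ : n ⟶ ⦋k⦌) (hn : n.len < k) :
    matchingComponent w (factorsBelow_of_lt σ hn) = w ≫ matchingπ X σ hn := by
  have e : σ = 𝟙 n ≫ σ := (Category.id_comp _).symm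
  have e' : matchingComponent w (factorsBelow_of_lt σ hn) =
      matchingComponent w (e ▸ factorsBelow_of_lt σ hn) := by
    congr 1
  rw [e', matchingComponent_eq w (𝟙 n) σ hn, op_id, X.map_id]
  exact congrArg (w ≫ ·) (Category.comp_id _)

lemma comp_matchingComponent {E' : C} (a : E' ⟶ E) {n : SimplexCategory} {σ : n ⟶ ⦋k⦌}
    (h : FactorsBelow σ) (x : E' ⟶ X _⦋k⦌) (hx : a ≫ w = x ≫ matchingMap X k) :
    a ≫ matchingComponent w h = x ≫ X.map σ.op := by
  obtain ⟨l, c, d, rfl, hl⟩ := id h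
  rw [matchingComponent_eq w c d hl, reassoc_of% hx, op_comp, X.map_comp,
    ← matchingMap_matchingπ X d hl, Category.assoc]

end Matching

variable [HasLimits C] [HasColimits C] {X : SimplicialObject C} {k : ℕ} {V : C}
  (a : X _⦋k⦌ ⟶ V) (b : V ⟶ matchingObj X k)

/-- The morphism `∐ X_k ⟶ X_n` given by the surjective operators `[n] ⟶ [k]`. -/
def attachMap (X : SimplicialObject C) (k : ℕ) (n : SimplexCategory) :
    (∐ fun _ : {σ : n ⟶ ⦋k⦌ // ¬ FactorsBelow σ} => X _⦋k⦌) ⟶ X.obj (op n) :=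
  Sigma.desc fun σ => X.map σ.1.op

/-- The objects of the simplicial object obtained from `X` by replacing `X_k` with `V`, where
`a ≫ b` is a factorization of the matching map `X_k ⟶ M_k X`: a copy of `V` is attached for each
surjective operator `[n] ⟶ [k]`. -/
def attachObj (n : SimplexCategory) : C :=
  pushout (attachMap X k n) (Limits.Sigma.map fun _ : {σ : n ⟶ ⦋k⦌ // ¬ FactorsBelow σ} => a)

/-- The inclusion of `X_n`. -/
def attachInl (n : SimplexCategory) : X.obj (op n) ⟶ attachObj a n := pushout.inl _ _

open Classical in
/-- The morphism from `V` given by an operator `[n] ⟶ [k]`. It is the inclusion of a summand if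
the operator is surjective, and it is induced by `V ⟶ M_k X` otherwise. -/
def attachInr {n : SimplexCategory} (σ : n ⟶ ⦋k⦌) : V ⟶ attachObj a n :=
  if h : FactorsBelow σ then matchingComponent b h ≫ attachInl a n
  else Sigma.ι (fun _ : {σ : n ⟶ ⦋k⦌ // ¬ FactorsBelow σ} => V) ⟨σ, h⟩ ≫ pushout.inr _ _

lemma attachInr_of_factorsBelow {n : SimplexCategory} {σ : n ⟶ ⦋k⦌} (h : FactorsBelow σ) :
    attachInr a b σ = matchingComponent b h ≫ attachInl a n :=
  dif_pos h

variable {a b}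

lemma comp_attachInr (hab : a ≫ b = matchingMap X k) {n : SimplexCategory} (σ : n ⟶ ⦋k⦌) :
    a ≫ attachInr a b σ = X.map σ.op ≫ attachInl a n := by
  by_cases h : FactorsBelow σ
  · rw [attachInr_of_factorsBelow a b h, ← Category.assoc, comp_matchingComponent b a h (𝟙 _)
      (by rw [hab, Category.id_comp]), Category.id_comp]
  · have h₁ := Sigma.ι (fun _ : {σ : n ⟶ ⦋k⦌ // ¬ FactorsBelow σ} => X _⦋k⦌) ⟨σ, h⟩ ≫=
      pushout.condition (f := attachMap X k n)
        (g := Limits.Sigma.map fun _ : {σ : n ⟶ ⦋k⦌ // ¬ FactorsBelow σ} => a)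
    rw [attachMap, Sigma.ι_desc_assoc, Sigma.ι_map_assoc] at h₁
    exact (congrArg (a ≫ ·) (dif_neg h)).trans h₁.symm

lemma attachObj_hom_ext {n : SimplexCategory} {E : C} {u w : attachObj a n ⟶ E}
    (h₁ : attachInl a n ≫ u = attachInl a n ≫ w)
    (h₂ : ∀ σ : n ⟶ ⦋k⦌, ¬ FactorsBelow σ → attachInr a b σ ≫ u = attachInr a b σ ≫ w) :
    u = w := by
  apply pushout.hom_ext h₁
  apply Sigma.hom_ext
  intro σ
  have := h₂ σ.1 σ.2
  rw [attachInr, dif_neg σ.2] at this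
  exact (Category.assoc _ _ _).symm.trans (this.trans (Category.assoc _ _ _))

variable (b) in
lemma exists_attachObj_desc {n : SimplexCategory} {E : C} (u : X.obj (op n) ⟶ E)
    (w : (n ⟶ ⦋k⦌) → (V ⟶ E))
    (h : ∀ σ : n ⟶ ⦋k⦌, ¬ FactorsBelow σ → a ≫ w σ = X.map σ.op ≫ u) :
    ∃ d : attachObj a n ⟶ E, attachInl a n ≫ d = u ∧
      ∀ σ : n ⟶ ⦋k⦌, ¬ FactorsBelow σ → attachInr a b σ ≫ d = w σ := by
  refine ⟨pushout.desc u (Sigma.desc fun σ => w σ.1) ?_, pushout.inl_desc _ _ _, fun σ hσ => ?_⟩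
  · apply Sigma.hom_ext
    intro σ
    rw [attachMap, Sigma.ι_desc_assoc, Sigma.ι_map_assoc, Sigma.ι_desc, h σ.1 σ.2]
  · rw [attachInr, dif_neg hσ]
    refine (Category.assoc _ _ _).trans ((congrArg (_ ≫ ·) (pushout.inr_desc _ _ _)).trans ?_)
    exact Sigma.ι_desc _ _

variable (hab : a ≫ b = matchingMap X k)

include hab in
/-- The action of an operator on the attached objects. On the copy of `V` indexed by a surjective
operator `σ` it is the morphism indexed by `g ≫ σ`, which need not be surjective. -/
lemma exists_attachObj_map {m n : SimplexCategory} (g : m ⟶ n) :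
    ∃ d : attachObj a n ⟶ attachObj a m, attachInl a n ≫ d = X.map g.op ≫ attachInl a m ∧
      ∀ σ : n ⟶ ⦋k⦌, attachInr a b σ ≫ d = attachInr a b (g ≫ σ) := by
  obtain ⟨d, h₁, h₂⟩ := exists_attachObj_desc b (X.map g.op ≫ attachInl a m)
    (fun σ => attachInr a b (g ≫ σ))
    (fun σ _ => by rw [comp_attachInr hab, op_comp, X.map_comp, Category.assoc])
  refine ⟨d, h₁, fun σ => ?_⟩
  by_cases h : FactorsBelow σ
  · rw [attachInr_of_factorsBelow a b h, attachInr_of_factorsBelow a b (h.comp g), Category.assoc,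
      h₁, ← Category.assoc, matchingComponent_map]
  · exact h₂ σ h

/-- The simplicial object obtained from `X` by replacing `X_k` with `V`, where `a ≫ b` is a
factorization of the matching map `X_k ⟶ M_k X`. -/
def attach : SimplicialObject C where
  obj n := attachObj a n.unop
  map g := (exists_attachObj_map hab g.unop).choose
  map_id n := by
    have h := (exists_attachObj_map hab (𝟙 n : n ⟶ n).unop).choose_spec
    refine attachObj_hom_ext (b := b) (h.1.trans ?_) (fun σ _ => (h.2 σ).trans ?_)
    · rw [Category.comp_id]
      exact (congrArg (· ≫ _) (X.map_id n)).trans (Category.id_comp _)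
    · rw [Category.comp_id, unop_id, Category.id_comp]
  map_comp {m n p} f g := by
    have h := (exists_attachObj_map hab (f ≫ g).unop).choose_spec
    have hf := (exists_attachObj_map hab f.unop).choose_spec
    have hg := (exists_attachObj_map hab g.unop).choose_spec
    refine attachObj_hom_ext (b := b) (h.1.trans ?_) (fun σ _ => (h.2 σ).trans ?_)
    · rw [← Category.assoc, hf.1, Category.assoc, hg.1, ← Category.assoc, ← X.map_comp]
      rfl
    · rw [← Category.assoc, hf.2, hg.2, unop_comp, Category.assoc]

lemma attachInl_map {m n : SimplexCategory} (g : m ⟶ n) :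
    attachInl a n ≫ (attach hab).map g.op = X.map g.op ≫ attachInl a m :=
  (exists_attachObj_map hab g).choose_spec.1

lemma attachInr_map {m n : SimplexCategory} (g : m ⟶ n) (σ : n ⟶ ⦋k⦌) :
    attachInr a b σ ≫ (attach hab).map g.op = attachInr a b (g ≫ σ) :=
  (exists_attachObj_map hab g).choose_spec.2 σ

/-- The inclusion of `X`. -/
def attachι : X ⟶ attach hab where
  app n := attachInl a n.unop
  naturality _ _ g := (attachInl_map hab g.unop).symm

/-- The inclusion of `X_n` is a pushout of a coproduct of copies of `a`. -/
lemma weakEquivalence_attachι_app [ModelCategory C] [Cofibration a] [WeakEquivalence a]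
    (n : SimplexCategory) : WeakEquivalence ((attachι hab).app (op n)) := by
  have h : trivialCofibrations C
      (Limits.Sigma.map fun _ : {σ : n ⟶ ⦋k⦌ // ¬ FactorsBelow σ} => a) :=
    MorphismProperty.colimMap _ (fun _ => (mem_trivialCofibrations_iff a).2 ⟨‹_›, ‹_›⟩)
  obtain ⟨_, _⟩ := (mem_trivialCofibrations_iff _).1 h
  exact inferInstanceAs (WeakEquivalence (pushout.inl (attachMap X k n) _))

/-- Nothing is attached below degree `k`, as there are no surjective operators to `[k]`. -/
lemma isIso_attachι_app_of_lt (n : SimplexCategory) (hn : n.len < k) :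
    IsIso ((attachι hab).app (op n)) := by
  have hσ (σ : n ⟶ ⦋k⦌) := factorsBelow_of_lt σ hn
  obtain ⟨d, hd, -⟩ := exists_attachObj_desc (a := a) b (𝟙 (X.obj (op n)))
    (fun σ => matchingComponent b (hσ σ)) (fun σ h => (h (hσ σ)).elim)
  refine ⟨d, hd, attachObj_hom_ext (b := b) ?_ (fun σ h => (h (hσ σ)).elim)⟩
  exact (Category.assoc _ _ _).symm.trans ((congrArg (· ≫ _) hd).trans
    ((Category.id_comp _).trans (Category.comp_id _).symm))

include hab in
/-- In degree `k` a single copy of `V` is attached, along `X_k` itself. -/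
lemma isIso_attachInr_id : IsIso (attachInr a b (𝟙 ⦋k⦌)) := by
  have hid (σ : ⦋k⦌ ⟶ ⦋k⦌) (h : ¬ FactorsBelow σ) : σ = 𝟙 _ :=
    (eq_id_or_exists_fac σ).resolve_right h
  have hid' : ¬ FactorsBelow (𝟙 (⦋k⦌ : SimplexCategory)) := by
    rintro ⟨l, c, d, h, hl⟩
    have : Mono c := mono_of_mono_fac h
    exact hl.not_ge (SimplexCategory.len_le_of_mono c)
  obtain ⟨d, hd, hd'⟩ := exists_attachObj_desc (a := a) b (n := ⦋k⦌) a (fun _ => 𝟙 V) (fun σ h => by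
    obtain rfl := hid σ h
    rw [op_id, X.map_id, Category.comp_id]
    exact (Category.id_comp a).symm)
  refine ⟨d, hd' _ hid', attachObj_hom_ext (b := b) ?_ (fun σ h => ?_)⟩
  · rw [reassoc_of% hd, comp_attachInr hab, op_id, X.map_id, Category.comp_id]
    exact Category.id_comp _
  · obtain rfl := hid σ h
    rw [reassoc_of% (hd' _ hid'), Category.comp_id]

omit [HasColimits C] in
/-- A simplicial map which is invertible in degrees at most `k` carries the lifting property of the
`k`th matching map. -/
lemma hasLiftingProperty_matchingMap_of_isIso {A B : C} (i : A ⟶ B) {X Y : SimplicialObject C}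
    (f : X ⟶ Y) (k : ℕ) (hf : ∀ n : SimplexCategory, n.len ≤ k → IsIso (f.app (op n)))
    [h : HasLiftingProperty i (matchingMap X k)] : HasLiftingProperty i (matchingMap Y k) := by
  rw [hasLiftingProperty_matchingMap_iff] at h ⊢
  intro a b hb hab
  have := hf ⦋k⦌ le_rfl
  have hf' (n : SimplexCategory) (hn : n.len < k) := hf n hn.le
  have hnat {m n : SimplexCategory} (g : m ⟶ n) (hm : m.len ≤ k) (hn : n.len ≤ k) :
      Y.map g.op ≫ (have := hf m hm; inv (f.app (op m))) =
        (have := hf n hn; inv (f.app (op n))) ≫ X.map g.op := by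
    have := hf m hm
    have := hf n hn
    rw [IsIso.comp_inv_eq, Category.assoc, f.naturality, IsIso.inv_hom_id_assoc]
  obtain ⟨l, h₁, h₂⟩ := h (a ≫ inv (f.app (op ⦋k⦌)))
    (fun j τ hj => b j τ hj ≫ (have := hf' j hj; inv (f.app (op j))))
    (fun τ ρ hj hi => by
      rw [Category.assoc, ← hnat ρ hi.le hj.le, ← Category.assoc, hb τ ρ hj hi])
    (fun j τ hj => by
      rw [Category.assoc, ← hnat τ hj.le le_rfl, ← Category.assoc, hab, Category.assoc])
  refine ⟨l ≫ f.app (op ⦋k⦌), ?_, fun j τ hj => ?_⟩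
  · rw [← Category.assoc, h₁, Category.assoc, IsIso.inv_hom_id, Category.comp_id]
  · have := hf' j hj
    rw [Category.assoc, ← f.naturality, ← Category.assoc, h₂, Category.assoc, IsIso.inv_hom_id,
      Category.comp_id]

/-- The `k`th matching map after the attachment is isomorphic to `b`, as the object is unchanged
below degree `k` and is `V` in degree `k`. -/
lemma hasLiftingProperty_matchingMap_attach {A B : C} (i : A ⟶ B) [HasLiftingProperty i b] :
    HasLiftingProperty i (matchingMap (attach hab) k) := by
  rw [hasLiftingProperty_matchingMap_iff]
  intro x y hy hxy
  let v : V ⟶ (attach hab).obj (op ⦋k⦌) := attachInr a b (𝟙 ⦋k⦌)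
  let ι (j : SimplexCategory) : X.obj (op j) ⟶ (attach hab).obj (op j) :=
    (attachι hab).app (op j)
  have hV : IsIso v := isIso_attachInr_id hab
  have hι (j : SimplexCategory) (hj : j.len < k) : IsIso (ι j) :=
    isIso_attachι_app_of_lt hab j hj
  have hnat {m n : SimplexCategory} (g : m ⟶ n) (hm : m.len < k) (hn : n.len < k) :
      (attach hab).map g.op ≫ (have := hι m hm; inv (ι m)) =
        (have := hι n hn; inv (ι n)) ≫ X.map g.op := by
    have := hι m hm
    have := hι n hn
    rw [IsIso.comp_inv_eq, Category.assoc, (attachι hab).naturality, IsIso.inv_hom_id_assoc]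
  have hb (j : SimplexCategory) (τ : j ⟶ ⦋k⦌) (hj : j.len < k) :
      v ≫ (attach hab).map τ.op = b ≫ matchingπ X τ hj ≫ ι j := by
    refine (attachInr_map hab τ (𝟙 _)).trans ?_
    rw [Category.comp_id, attachInr_of_factorsBelow a b (factorsBelow_of_lt τ hj),
      matchingComponent_of_lt, Category.assoc]
    rfl
  obtain ⟨u, hu⟩ := exists_matchingObj_lift (X := X)
    (fun j τ hj => y j τ hj ≫ (have := hι j hj; inv (ι j)))
    (fun τ ρ hj hi => by
      rw [Category.assoc, ← hnat ρ hi hj, ← Category.assoc, hy τ ρ hj hi])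
  have sq : CommSq (x ≫ inv v) i b u := ⟨by
    apply matchingObj_hom_ext
    intro j τ hj
    have := hι j hj
    rw [Category.assoc, Category.assoc, Category.assoc, hu, ← Category.assoc i, hxy,
      IsIso.eq_comp_inv, Category.assoc, Category.assoc, Category.assoc, ← hb,
      IsIso.inv_hom_id_assoc]⟩
  refine ⟨sq.lift ≫ v, ?_, fun j τ hj => ?_⟩
  · rw [← Category.assoc, sq.fac_left, Category.assoc, IsIso.inv_hom_id, Category.comp_id]
  · have := hι j hj
    rw [Category.assoc, hb, ← Category.assoc, ← Category.assoc, sq.fac_right, hu, Category.assoc,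
      IsIso.inv_hom_id, Category.comp_id]

end Attach

/-! ### The sequence of attachments and its colimit -/

section ReedyReplacement

variable {C : Type u} [Category.{v} C] [HasLimits C] [HasColimits C] [ModelCategory C]

/-- A factorization of the matching map as a trivial cofibration followed by a fibration. -/
abbrev matchingFactorization (X : SimplicialObject C) (k : ℕ) :
    (trivialCofibrations C).MapFactorizationData (fibrations C) (matchingMap X k) :=
  MorphismProperty.factorizationData _ _ _

/-- The sequence of simplicial objects in which the `k`th matching map is replaced with a
fibration in the `k`th step. -/
def reedySequence (X : SimplicialObject C) (k : ℕ) : SimplicialObject C :=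
  Nat.rec X (fun k Y => attach (matchingFactorization Y k).fac) k

/-- The transition maps of the sequence. -/
def reedySequenceMap (X : SimplicialObject C) (k : ℕ) :
    reedySequence X k ⟶ reedySequence X (k + 1) :=
  attachι (matchingFactorization (reedySequence X k) k).fac

lemma weakEquivalence_reedySequenceMap_app (X : SimplicialObject C) (k : ℕ) (n : SimplexCategory) :
    WeakEquivalence ((reedySequenceMap X k).app (op n)) :=
  weakEquivalence_attachι_app _ n

lemma isIso_reedySequenceMap_app (X : SimplicialObject C) (k : ℕ) (n : SimplexCategory)
    (hn : n.len < k) : IsIso ((reedySequenceMap X k).app (op n)) :=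
  isIso_attachι_app_of_lt _ n hn

lemma fibration_matchingMap_reedySequence (X : SimplicialObject C) (k : ℕ) :
    Fibration (matchingMap (reedySequence X (k + 1)) k) := by
  constructor
  rw [← trivialCofibrations_rlp]
  intro A B i hi
  obtain ⟨_, _⟩ := (mem_trivialCofibrations_iff i).1 hi
  exact hasLiftingProperty_matchingMap_attach (matchingFactorization (reedySequence X k) k).fac i

/-- The Reedy fibrant replacement up to level weak equivalence. -/
def reedyReplacement (X : SimplicialObject C) : SimplicialObject C :=
  colimit (Functor.ofSequence (reedySequenceMap X))

/-- The maps from the terms of the sequence to the Reedy fibrant replacement. -/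
def reedySequenceι (X : SimplicialObject C) (k : ℕ) : reedySequence X k ⟶ reedyReplacement X :=
  colimit.ι (Functor.ofSequence (reedySequenceMap X)) k

lemma reedySequenceMap_reedySequenceι (X : SimplicialObject C) (k : ℕ) :
    reedySequenceMap X k ≫ reedySequenceι X (k + 1) = reedySequenceι X k := by
  have := colimit.w (Functor.ofSequence (reedySequenceMap X)) (homOfLE (Nat.le_add_right k 1))
  rw [Functor.ofSequence_map_homOfLE_succ] at this
  exact this

/-- In each degree the sequence is eventually constant. -/
lemma isIso_reedySequenceι_app (X : SimplicialObject C) (k : ℕ) (n : SimplexCategory)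
    (hn : n.len < k) : IsIso ((reedySequenceι X k).app (op n)) := by
  let F := Functor.ofSequence (reedySequenceMap X) ⋙ (evaluation _ C).obj (op n)
  have hF : F.IsEventuallyConstantFrom k := by
    intro j f
    obtain ⟨d, rfl⟩ := Nat.exists_eq_add_of_le (leOfHom f)
    induction d with
    | zero =>
      obtain rfl : f = 𝟙 _ := Subsingleton.elim _ _
      infer_instance
    | succ d ih =>
      have := ih (homOfLE (Nat.le_add_right k d))
      have h : F.map (homOfLE (Nat.le_add_right (k + d) 1)) =
          (reedySequenceMap X (k + d)).app (op n) :=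
        congrArg (fun g => NatTrans.app g (op n)) (Functor.ofSequence_map_homOfLE_succ _ _)
      have : IsIso (F.map (homOfLE (Nat.le_add_right (k + d) 1))) := by
        rw [h]
        exact isIso_reedySequenceMap_app X (k + d) n (by omega)
      have e : f = homOfLE (Nat.le_add_right k d) ≫ homOfLE (Nat.le_add_right (k + d) 1) :=
        Subsingleton.elim _ _
      rw [e, F.map_comp]
      infer_instance
  exact hF.isIso_ι_of_isColimit (isColimitOfPreserves ((evaluation _ C).obj (op n))
    (colimit.isColimit (Functor.ofSequence (reedySequenceMap X))))

lemma weakEquivalence_reedySequenceι_app (X : SimplicialObject C) (n : SimplexCategory) :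
    WeakEquivalence ((reedySequenceι X 0).app (op n)) := by
  have h (d : ℕ) : ∀ k, n.len + 1 = k + d →
      WeakEquivalence ((reedySequenceι X k).app (op n)) := by
    induction d with
    | zero =>
      intro k hk
      have := isIso_reedySequenceι_app X k n (by omega)
      infer_instance
    | succ d ih =>
      intro k hk
      have := ih (k + 1) (by omega)
      have := weakEquivalence_reedySequenceMap_app X k n
      rw [← reedySequenceMap_reedySequenceι, NatTrans.comp_app]
      infer_instance
  exact h (n.len + 1) 0 (by omega)

/-- Every simplicial object is level weakly equivalent to a Reedy fibrant one. -/
theorem exists_reedyFibrant_replacement (X : SimplicialObject C) :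
    ∃ (W : SimplicialObject C) (f : X ⟶ W), IsLevelWeakEquivalence f ∧
      IsReedyFibration (terminal.from W) := by
  refine ⟨reedyReplacement X, reedySequenceι X 0,
    fun n => (weakEquivalence_reedySequenceι_app X ⦋n⦌).mem,
    (isReedyFibration_terminal_from_iff _).2 fun k => ⟨?_⟩⟩
  rw [← trivialCofibrations_rlp]
  intro A B i hi
  obtain ⟨_, _⟩ := (mem_trivialCofibrations_iff i).1 hi
  have := fibration_matchingMap_reedySequence X k
  exact hasLiftingProperty_matchingMap_of_isIso i (reedySequenceι X (k + 1)) k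
    fun n hn => isIso_reedySequenceι_app X _ n (Nat.lt_succ_of_le hn)

end ReedyReplacement

/-! ### Prolongations of Quillen equivalences -/

section QuillenEquivalence

lemma weakEquivalence_of_naturality {C : Type u} [Category.{v} C] [ModelCategory C]
    {X Y : SimplicialObject C} (f : X ⟶ Y) {m n : SimplexCategoryᵒᵖ} (g : m ⟶ n)
    (hm : WeakEquivalence (f.app m)) (hn : WeakEquivalence (f.app n))
    (hX : WeakEquivalence (X.map g)) : WeakEquivalence (Y.map g) := by
  have : WeakEquivalence (f.app m ≫ Y.map g) := by
    rw [← f.naturality]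
    infer_instance
  exact weakEquivalence_of_precomp (f.app m) (Y.map g)

/-- Homotopical constancy is invariant under level weak equivalences. -/
lemma IsHomotopicallyConstant.of_isLevelWeakEquivalence {C : Type u} [Category.{v} C]
    [ModelCategory C] {X Y : SimplicialObject C} {f : X ⟶ Y}
    (hX : IsHomotopicallyConstant X) (hf : IsLevelWeakEquivalence f) :
    IsHomotopicallyConstant Y :=
  ⟨fun n i => (weakEquivalence_of_naturality f _ ⟨hf _⟩ ⟨hf _⟩ ⟨hX.1 n i⟩).mem,
    fun n i => (weakEquivalence_of_naturality f _ ⟨hf _⟩ ⟨hf _⟩ ⟨hX.2 n i⟩).mem⟩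

variable {C : Type u₁} [Category.{v} C] [HasLimits C] [HasColimits C] [ModelCategory C]
  [ModelCategory (SimplicialObject C)]
  {D : Type u₂} [Category.{v} D] [HasLimits D] [HasColimits D] [ModelCategory D]
  [ModelCategory (SimplicialObject D)] {L : C ⥤ D} {R : D ⥤ C} {adj : L ⊣ R}

/-- The prolongation of a Quillen equivalence is a Quillen equivalence. The derived counit and the
comparison of a bifibrant `X` with the image of a Reedy fibrant replacement of `L X` are levelwise
adjoint to weak equivalences from cofibrant to fibrant objects. -/
theorem IsQuillenEquivalence.isQuillenEquivalence_prolongAdj (h : IsQuillenEquivalence adj)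
    (hC : IsCanonicalModelStructure C) (hC' : IsSimplicialModelStructure C)
    (hD : IsCanonicalModelStructure D) (hD' : IsSimplicialModelStructure D) :
    IsQuillenEquivalence (prolongAdj adj) := by
  have hadj := h.isQuillenAdjunction
  obtain ⟨E, α, β, hα, hβ⟩ := h.exists_equivalence
  have hiff {X : C} {Y : D} (hX : IsCofibrant X) (hY : IsFibrant Y) (f : L.obj X ⟶ Y) :
      WeakEquivalence (adj.homEquiv X Y f) ↔ WeakEquivalence f :=
    hadj.weakEquivalence_homEquiv_iff α β f
  refine (hadj.isQuillenAdjunction_prolongAdj hC hC' hD hD').isQuillenEquivalence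
    (fun Y _ => ?_) (fun X _ _ => ?_)
  · let p := CofibrantObject.HoCat.pResolutionObj ((prolong R).obj Y)
    refine ⟨_, p, inferInstance, inferInstance, ⟨hD.weakEquivalence_of_level _ fun n => ?_⟩⟩
    have h₁ := hC.weakEquivalence_app_of_fibration hC' p ⦋n⦌
    have h₂ := hC.isCofibrant_obj (CofibrantObject.HoCat.resolutionObj ((prolong R).obj Y)) ⦋n⦌
    have h₃ := hD.isFibrant_obj hD' Y ⦋n⦌
    have e : adj.homEquiv _ _ ((((prolongAdj adj).homEquiv _ _).symm p).app (op ⦋n⦌)) =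
        p.app (op ⦋n⦌) :=
      (prolongAdj_homEquiv_app adj _ _).symm.trans
        (congrArg (fun q => NatTrans.app q (op ⦋n⦌)) (Equiv.apply_symm_apply _ p))
    exact ((hiff h₂ h₃ _).1 (e.symm ▸ h₁)).mem
  · obtain ⟨W, f, hf, hW⟩ := exists_reedyFibrant_replacement ((prolong L).obj X)
    have hX (n : ℕ) : IsCofibrant (X _⦋n⦌) := hC.isCofibrant_obj X ⦋n⦌
    obtain ⟨⟨hδ, hσ⟩, -⟩ := (hC.isFibrant_iff X).1 inferInstance
    have hLX : IsHomotopicallyConstant ((prolong L).obj X) :=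
      ⟨fun n i => by
        have : WeakEquivalence (X.δ i) := ⟨hδ n i⟩
        have := hX n
        have := hX (n + 1)
        exact (hadj.weakEquivalence_map_of_isCofibrant (X.δ i)).mem,
      fun n i => by
        have : WeakEquivalence (X.σ i) := ⟨hσ n i⟩
        have := hX n
        have := hX (n + 1)
        exact (hadj.weakEquivalence_map_of_isCofibrant (X.σ i)).mem⟩
    have hW' : IsFibrant W := (hD.isFibrant_iff W).2 ⟨hLX.of_isLevelWeakEquivalence hf, hW⟩
    refine ⟨W, (prolongAdj adj).homEquiv _ _ f, hW', ⟨hC.weakEquivalence_of_level _ fun n => ?_⟩⟩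
    rw [prolongAdj_homEquiv_app]
    exact ((hiff (hX n) (hD.isFibrant_obj hD' W ⦋n⦌) _).2 ⟨hf n⟩).mem

end QuillenEquivalence

end SimplicialReplacement

end

theorem proposition6p1
    {C : Type u₁} [Category.{v} C] [HasLimits C] [HasColimits C] [ModelCategory C]
    {D : Type u₂} [Category.{v} D] [HasLimits D] [HasColimits D] [ModelCategory D]
    [ModelCategory (SimplicialObject C)] [ModelCategory (SimplicialObject D)]
    (hC : SimplicialReplacement.IsCanonicalModelStructure C)
    (hC' : SimplicialReplacement.IsSimplicialModelStructure C)
    (hD : SimplicialReplacement.IsCanonicalModelStructure D)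
    (hD' : SimplicialReplacement.IsSimplicialModelStructure D)
    {L : C ⥤ D} {R : D ⥤ C} (adj : L ⊣ R)
    (hadj : SimplicialReplacement.IsQuillenAdjunction adj) :
    SimplicialReplacement.IsQuillenAdjunction (SimplicialReplacement.prolongAdj adj) ∧
    (∃ A : SimplicialReplacement.SimplicialAdjunction (SimplicialReplacement.prolongAdj adj),
      A.left.IsLevelwise ∧ A.right.IsLevelwise) ∧
    (SimplicialReplacement.IsQuillenEquivalence adj →
      SimplicialReplacement.IsQuillenEquivalence (SimplicialReplacement.prolongAdj adj)) := by
  exact ⟨hadj.isQuillenAdjunction_prolongAdj hC hC' hD hD',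
    ⟨SimplicialReplacement.prolongSimplicialAdjunction adj,
      SimplicialReplacement.prolongSimplicial_isLevelwise L,
      SimplicialReplacement.prolongSimplicial_isLevelwise R⟩,
    fun h => h.isQuillenEquivalence_prolongAdj hC hC' hD hD'⟩
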